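/- \textbf{Model.} A network is a connected undirected graph $G=(V,E)$ with $n\ge 2$ nodes and nonnegative integer edge weights. The nodes have distinct identity numbers, and for some fixed $a$ all identity numbers are less than $n^a$ and all edge weights are at most $n^a$. Let $d(u,v)$ be the minimum total weight of a path between $u$ and $v$, let $h(u,v)$ be the minimum number of edges of a simple path between $u$ and $v$ of total weight $d(u,v)$, and let $S=\max_{u,v}h(u,v)$ be the shortest-path diameter. A node initially knows $n$, its own identity number, and the identity numbers of its neighbours together with the weights of its incident edges (but not $S$), and it has private random coins. A word is a block of $O(\log n)$ bits. Computation proceeds in synchronous rounds, and in each round a node may send one message of one word along each incident edge (CONGEST model). At the end every node $u$ stops with a sketch $L(u)$, a list of words, and for any $u,v\in V$ an estimate $d'(u,v)$ of $d(u,v)$ is computed from $L(u)$ and $L(v)$ (and $n$) alone. For $\varepsilon\in(0,1)$, the node $v$ is $\varepsilon$-far from $u$ if $|\{w\in V: d(u,w)<d(u,v)\}|\ge\varepsilon n$. The sketches have stretch $f$ with $\varepsilon$-slack if $d(u,v)\le d'(u,v)\le f\,d(u,v)$ for all $u,v\in V$ such that $v$ is $\varepsilon$-far from $u$. \textbf{Theorem.}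 For all constants $a$ and $c$ there are a constant $C$ and a randomized distributed sketching algorithm such that on every network as above, with probability at least $1-n^{-c}$: (1) all nodes stop within $C\,S\log^4 n$ rounds; (2) at most $C\,S\,|E|\log^4 n$ messages are sent in total; (3) every sketch has at most $C\log^4 n$ words; (4) the sketches are gracefully degrading: $d(u,v)\le d'(u,v)$ for all $u,v\in V$, and simultaneously for every $\varepsilon\in(0,1)$ they have stretch $C\left(1+\log\frac1\varepsilon\right)$ with $\varepsilon$-slack. The constant in the word size $O(\log n)$ also depends only on $a$ and $c$. -/

import Mathlib

open MeasureTheory ProbabilityTheory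

/-! ### Weighted networks -/

/-- A weighted, undirected, connected network with `n` nodes.  The nodes carry distinct identity
numbers below `n ^ a`, and every edge has a nonnegative integer weight which is at most `n ^ a`.
The names `0, …, n - 1` of the nodes are not visible to the nodes themselves; they only know
identity numbers. -/
structure Network (n a : ℕ) where
  graph : SimpleGraph (Fin n)
  connected : graph.Connected
  id : Fin n → ℕ
  id_injective : Function.Injective id
  id_lt : ∀ v, id v < n ^ a
  weight : Sym2 (Fin n) → ℕ
  weight_le : ∀ e ∈ graph.edgeSet, weight e ≤ n ^ a

namespace Network

variable {n a : ℕ} (N : Network n a)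

/-- The total weight of a walk. -/
def walkWeight {u v : Fin n} (p : N.graph.Walk u v) : ℕ := (p.edges.map N.weight).sum

/-- The distance `d(u,v)`: the minimum total weight of a simple path between `u` and `v`. -/
noncomputable def dist (u v : Fin n) : ℕ :=
  sInf {x | ∃ p : N.graph.Walk u v, p.IsPath ∧ N.walkWeight p = x}

/-- `h(u,v)`: the minimum number of edges of a simple path of total weight `d(u,v)`. -/
noncomputable def hops (u v : Fin n) : ℕ :=
  sInf {x | ∃ p : N.graph.Walk u v, p.IsPath ∧ N.walkWeight p = N.dist u v ∧ p.length = x}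

/-- The shortest-path diameter `S`: the maximum of `h(u,v)` over all pairs of nodes. -/
noncomputable def shortestPathDiam : ℕ :=
  Finset.univ.sup fun u => Finset.univ.sup fun v => N.hops u v

/-- The number `|E|` of edges. -/
noncomputable def numEdges : ℕ := N.graph.edgeSet.ncard

/-- `v` is `ε`-far from `u`: at least `ε n` nodes are strictly closer to `u` than `v` is. -/
def IsFar (ε : ℝ) (u v : Fin n) : Prop :=
  ε * n ≤ ({w | N.dist u w < N.dist u v}.ncard : ℝ)

/-- The estimates `d'` have stretch `f` with `ε`-slack. -/
def HasStretchWithSlack (d' : Fin n → Fin n → ℕ) (f ε : ℝ) : Prop :=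
  ∀ u v, N.IsFar ε u v → N.dist u v ≤ d' u v ∧ (d' u v : ℝ) ≤ f * N.dist u v

/-- The estimates `d'` never underestimate a distance, and they have stretch `f ε` with `ε`-slack
simultaneously for all `ε ∈ (0,1)`. -/
def IsGracefullyDegrading (d' : Fin n → Fin n → ℕ) (f : ℝ → ℝ) : Prop :=
  (∀ u v, N.dist u v ≤ d' u v) ∧
    ∀ ε ∈ Set.Ioo (0 : ℝ) 1, N.HasStretchWithSlack d' (f ε) ε

end Network

/-! ### Sketching algorithms in the CONGEST model -/

/-- A word: a block of `b log₂ n` bits. -/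
abbrev Word (n b : ℕ) : Type := Fin (n ^ b)

/-- The initial knowledge of a node: its own identity number, and the finite partial map that sends
the identity number of each neighbour to the weight of the edge to this neighbour. -/
structure LocalInput where
  id : ℕ
  nbrWeight : ℕ → Option ℕ

/-- A randomized sketching algorithm for `n`-node networks with messages of one word.  All nodes
run the same program, which may depend on `n`.  In a round a node sends at most one message to each
neighbour, and then it updates its state from the messages it received in this round; neighbours
are addressed by identity numbers.  A node stops when its state has an output, which is its sketch.
`estimate` is the procedure that computes a distance estimate from two sketches. -/
structure SketchingAlgorithm (n b : ℕ) where
  State : Type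
  /-- The number of private fair coins of a node. -/
  coins : ℕ
  init : LocalInput → (Fin coins → Bool) → State
  /-- The message to the neighbour with the given identity number, if any. -/
  send : State → ℕ → Option (Word n b)
  /-- The new state, given the old one and for each identity number the message received from
  the neighbour with this number, if any. -/
  receive : State → (ℕ → Option (Word n b)) → State
  output : State → Option (List (Word n b))
  estimate : List (Word n b) → List (Word n b) → ℕ

open Classical in
/-- The initial knowledge of node `v`. -/
noncomputable def Network.localInput {n a : ℕ} (N : Network n a) (v : Fin n) : LocalInput where
  id := N.id v
  nbrWeight := Function.extend N.id
    (fun u => if N.graph.Adj v u then some (N.weight s(v, u)) else none) (fun _ => none)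

namespace SketchingAlgorithm

variable {n a b : ℕ} (A : SketchingAlgorithm n b) (N : Network n a)

/-- The outcomes of all coins of all nodes. -/
abbrev CoinFlips : Type := Fin n → Fin A.coins → Bool

/-- All coins are fair and independent. -/
noncomputable def coinLaw : Measure A.CoinFlips := uniformOn Set.univ

open Classical in
/-- The message that `v` sends to `u` in a round that starts with the states `c`. Only nodes which
have not stopped send messages, and they send them to neighbours only. -/
noncomputable def message (c : Fin n → A.State) (v u : Fin n) : Option (Word n b) :=
  if N.graph.Adj v u ∧ A.output (c v) = none then A.send (c v) (N.id u) else none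

open Classical in
/-- The states of all nodes after one round that starts with the states `c`. A node which has
stopped does not change any more. -/
noncomputable def nextConfig (c : Fin n → A.State) (u : Fin n) : A.State :=
  if A.output (c u) = none then
    A.receive (c u) (Function.extend N.id (fun v => A.message N c v u) (fun _ => none))
  else c u

/-- The states of all nodes after `t` rounds. -/
noncomputable def config (ω : A.CoinFlips) : ℕ → Fin n → A.State
  | 0 => fun v => A.init (N.localInput v) (ω v)
  | t + 1 => A.nextConfig N (config ω t)

/-- The total number of messages sent during the first `T` rounds. -/
noncomputable def messageCount (ω : A.CoinFlips) (T : ℕ) : ℕ :=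
  ∑ t ∈ Finset.range T,
    {p : Fin n × Fin n | (A.message N (A.config N ω t) p.1 p.2).isSome}.ncard

/-- After `T` rounds every node has stopped, and `L v` is the sketch of node `v`. -/
def Completes (ω : A.CoinFlips) (T : ℕ) (L : Fin n → List (Word n b)) : Prop :=
  ∀ v, A.output (A.config N ω T v) = some (L v)

end SketchingAlgorithm

/-!
The sketches are those of a single Thorup–Zwick hierarchy.  Every node draws a level by tossing coins
until the first tail, and the highest level `k` is chosen such that about `Λ` nodes attain it, where
`Λ` is a multiple of `log n`.  The sketch of `u` is its *bunch*: the nodes `w`, with their distances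
from `u`, such that no node which is closer to `u` than `w` has a higher level (ties between
distances are broken by identity numbers).

*Size.*  With high probability every set of `Λ * 2 ^ i` nodes that matters contains a node of level
at least `i`, and at most `5 * Λ` of them if it is at most twice as large (`WellSpread`).  Hence the
bunch has `O(Λ)` nodes of each level, `O(log² n)` in total (`Network.card_isBunch_le`).

*Stretch.*  Estimate `d(u,v)` by the shortest detour through a common node of the two bunches.  If a
node of level `i` is within distance `x * d(u,v)` of `u`, then either the closest such node serves,
or a node of level at least `i + 1` is within distance `(x + 1) * d(u,v)` of `v`
(`Network.exists_isBunch_isBunch`).  If `v` is `ε`-far from `u`, then the nodes closer to `u` than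
`v` include one whose level is at least `k - log₂ (1 / ε) - O(1)`, so that the stretch is
`O(1 + log (1 / ε))`.

*Computation.*  The bunch with respect to walks of at most `t + 1` edges is determined by the bunches
of the node and its neighbours with respect to walks of at most `t` edges (`Network.table_succ`).
All these bunches have `O(log² n)` entries, so each step of this recursion can be simulated in as
many rounds of one word per edge (`BroadcastProtocol.config_simulation`).  After `S` steps the
tables are final.

*Termination.*  The nodes do not know `S`; each of them keeps track of the last time `τ` of a change
that it has heard of, and it stops at the first time `t ≥ 3 τ + 2`.  Then no table within `2 τ + 1`
edges changes in step `τ`.  Neighbours with unchanging tables know the same nodes of the highest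
level; such a node is within `τ` edges of each of them, so nothing is at `2 τ + 1` edges, and these
nodes are the whole network (`Network.quiet_of_forall_dist_le`).  Therefore all nodes stop at the
same time, after at most `3 S + 2` steps, and with final tables (`Network.settled_of_settled`,
`Network.table_eq_of_settled`).
-/

/-! ### Shortest walks with few edges -/

namespace Network

variable {n a : ℕ} (N : Network n a)

/-- The minimum total weight of a walk with at most `t` edges, computed in the manner of
Bellman and Ford; it is `⊤` if there is no such walk. -/
noncomputable def hopDist : ℕ → Fin n → Fin n → ℕ∞
  | 0, u, w => if u = w then 0 else ⊤
  | t + 1, u, w => min (hopDist t u w)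
      (⨅ x, ⨅ _ : N.graph.Adj u x, (N.weight s(u, x) : ℕ∞) + hopDist t x w)

theorem hopDist_self (t : ℕ) (u : Fin n) : N.hopDist t u u = 0 := by
  induction t with
  | zero => simp [hopDist]
  | succ t ih => simp [hopDist, ih]

theorem hopDist_succ_le (t : ℕ) (u w : Fin n) : N.hopDist (t + 1) u w ≤ N.hopDist t u w :=
  min_le_left _ _

theorem hopDist_antitone {s t : ℕ} (h : s ≤ t) (u w : Fin n) :
    N.hopDist t u w ≤ N.hopDist s u w :=
  antitone_nat_of_succ_le (f := fun t => N.hopDist t u w) (fun t => N.hopDist_succ_le t u w) h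

theorem hopDist_succ_le_of_adj (t : ℕ) {u x : Fin n} (h : N.graph.Adj u x) (w : Fin n) :
    N.hopDist (t + 1) u w ≤ (N.weight s(u, x) : ℕ∞) + N.hopDist t x w :=
  (min_le_right _ _).trans (iInf₂_le x h)

theorem hopDist_succ_cases (t : ℕ) (u w : Fin n) :
    N.hopDist (t + 1) u w = N.hopDist t u w ∨
      ∃ x, N.graph.Adj u x ∧
        N.hopDist (t + 1) u w = (N.weight s(u, x) : ℕ∞) + N.hopDist t x w := by
  have : Nonempty (Fin n) := ⟨u⟩
  obtain ⟨x, hx⟩ := exists_eq_ciInf_of_finite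
    (f := fun x => ⨅ _ : N.graph.Adj u x, (N.weight s(u, x) : ℕ∞) + N.hopDist t x w)
  rcases min_choice (N.hopDist t u w)
    (⨅ x, ⨅ _ : N.graph.Adj u x, (N.weight s(u, x) : ℕ∞) + N.hopDist t x w) with h | h
  · exact Or.inl h
  · by_cases hadj : N.graph.Adj u x
    · refine Or.inr ⟨x, hadj, ?_⟩
      rw [hopDist, h, ← hx]
      simp [hadj]
    · left
      simp only [hadj, iInf_false] at hx
      rw [hopDist, ← hx]
      simp

theorem hopDist_length_le {u w : Fin n} (p : N.graph.Walk u w) :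
    N.hopDist p.length u w ≤ N.walkWeight p := by
  induction p with
  | nil => simp [hopDist_self]
  | cons h p ih =>
    refine (N.hopDist_succ_le_of_adj _ h _).trans ?_
    simp only [walkWeight, SimpleGraph.Walk.edges_cons, List.map_cons, List.sum_cons,
      Nat.cast_add]
    gcongr
    exact ih

/-- A finite value of `hopDist` is the weight of a walk with at most `t` edges. -/
theorem exists_walk_of_hopDist {t : ℕ} {u w : Fin n} {d : ℕ} (h : N.hopDist t u w = d) :
    ∃ p : N.graph.Walk u w, p.length ≤ t ∧ N.walkWeight p = d := by
  induction t generalizing u d with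
  | zero =>
    by_cases huw : u = w
    · subst huw
      refine ⟨.nil, le_rfl, ?_⟩
      simp only [hopDist, if_true] at h
      simpa [walkWeight] using (by exact_mod_cast h : (0 : ℕ) = d)
    · simp [hopDist, huw] at h
  | succ t ih =>
    rcases N.hopDist_succ_cases t u w with h' | ⟨x, hx, h'⟩
    · obtain ⟨p, hp, hd⟩ := ih (h' ▸ h)
      exact ⟨p, by omega, hd⟩
    · rw [h] at h'
      have hne : N.hopDist t x w ≠ ⊤ := by
        intro htop
        simp [htop] at h'
      obtain ⟨e, he⟩ := ENat.ne_top_iff_exists.mp hne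
      obtain ⟨p, hp, hd⟩ := ih he.symm
      refine ⟨.cons hx p, by simpa using hp, ?_⟩
      rw [← he] at h'
      have h'' : d = N.weight s(u, x) + e := by exact_mod_cast h'
      simp only [walkWeight, SimpleGraph.Walk.edges_cons, List.map_cons, List.sum_cons]
      rw [h'', ← hd, walkWeight]

theorem walkWeight_bypass_le {u v : Fin n} (p : N.graph.Walk u v) :
    N.walkWeight p.bypass ≤ N.walkWeight p :=
  (p.edges_bypass_sublist_edges.map N.weight).sum_le_sum (by simp)

theorem dist_le_walkWeight {u v : Fin n} (p : N.graph.Walk u v) :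
    N.dist u v ≤ N.walkWeight p :=
  le_trans (Nat.sInf_le ⟨p.bypass, p.bypass_isPath, rfl⟩) (N.walkWeight_bypass_le p)

theorem exists_path_dist (u v : Fin n) :
    ∃ p : N.graph.Walk u v, p.IsPath ∧ N.walkWeight p = N.dist u v := by
  obtain ⟨p⟩ := N.connected.preconnected u v
  exact Nat.sInf_mem (s := {x | ∃ p : N.graph.Walk u v, p.IsPath ∧ N.walkWeight p = x})
    ⟨_, p.bypass, p.bypass_isPath, rfl⟩

theorem exists_path_hops (u v : Fin n) :
    ∃ p : N.graph.Walk u v, p.IsPath ∧ N.walkWeight p = N.dist u v ∧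
      p.length = N.hops u v := by
  obtain ⟨p, hp, hd⟩ := N.exists_path_dist u v
  exact Nat.sInf_mem (s := {x | ∃ p : N.graph.Walk u v, p.IsPath ∧
    N.walkWeight p = N.dist u v ∧ p.length = x}) ⟨_, p, hp, hd, rfl⟩

theorem dist_self (u : Fin n) : N.dist u u = 0 := by
  simpa [walkWeight] using N.dist_le_walkWeight (.nil : N.graph.Walk u u)

theorem dist_comm (u v : Fin n) : N.dist u v = N.dist v u := by
  have key : ∀ u v, N.dist u v ≤ N.dist v u := fun u v => by
    obtain ⟨p, -, hd⟩ := N.exists_path_dist v u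
    refine (N.dist_le_walkWeight p.reverse).trans_eq ?_
    rw [← hd, walkWeight, walkWeight, SimpleGraph.Walk.edges_reverse, List.map_reverse,
      List.sum_reverse]
  exact le_antisymm (key u v) (key v u)

theorem dist_triangle (u v w : Fin n) : N.dist u w ≤ N.dist u v + N.dist v w := by
  obtain ⟨p, -, hp⟩ := N.exists_path_dist u v
  obtain ⟨q, -, hq⟩ := N.exists_path_dist v w
  refine (N.dist_le_walkWeight (p.append q)).trans_eq ?_
  rw [← hp, ← hq, walkWeight, walkWeight, walkWeight, SimpleGraph.Walk.edges_append,
    List.map_append, List.sum_append]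

theorem hops_le_shortestPathDiam (u v : Fin n) : N.hops u v ≤ N.shortestPathDiam :=
  (Finset.le_sup (f := fun v => N.hops u v) (Finset.mem_univ v)).trans
    (Finset.le_sup (f := fun u => Finset.univ.sup fun v => N.hops u v) (Finset.mem_univ u))

theorem hopDist_eq_dist {t : ℕ} (h : N.shortestPathDiam ≤ t) (u w : Fin n) :
    N.hopDist t u w = N.dist u w := by
  obtain ⟨p, -, hp, hl⟩ := N.exists_path_hops u w
  have hle : N.hopDist t u w ≤ N.dist u w := by
    rw [← hp]
    refine (N.hopDist_antitone ?_ u w).trans (N.hopDist_length_le p)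
    exact hl ▸ (N.hops_le_shortestPathDiam u w).trans h
  obtain ⟨d, hd⟩ := ENat.ne_top_iff_exists.mp (ne_top_of_le_ne_top (ENat.natCast_ne_top _) hle)
  obtain ⟨q, -, hq⟩ := N.exists_walk_of_hopDist hd.symm
  refine le_antisymm hle ?_
  rw [← hd, ← hq]
  exact_mod_cast N.dist_le_walkWeight q

theorem hopDist_min_shortestPathDiam (t : ℕ) (u w : Fin n) :
    N.hopDist (min t N.shortestPathDiam) u w = N.hopDist t u w := by
  rcases le_total t N.shortestPathDiam with h | h
  · rw [min_eq_left h]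
  · rw [min_eq_right h, N.hopDist_eq_dist h, N.hopDist_eq_dist le_rfl]

theorem shortestPathDiam_lt (hn : 0 < n) : N.shortestPathDiam < n := by
  refine (Finset.sup_lt_iff hn).mpr fun u _ => (Finset.sup_lt_iff hn).mpr fun v _ => ?_
  obtain ⟨p, hp, -, hl⟩ := N.exists_path_hops u v
  simpa [hl] using hp.length_lt

theorem shortestPathDiam_pos (hn : 2 ≤ n) : 0 < N.shortestPathDiam := by
  obtain ⟨p, -, -, hl⟩ := N.exists_path_hops ⟨0, by omega⟩ ⟨1, by omega⟩
  refine lt_of_lt_of_le ?_ (N.hops_le_shortestPathDiam ⟨0, by omega⟩ ⟨1, by omega⟩)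
  rw [← hl, Nat.pos_iff_ne_zero]
  intro h0
  simpa using SimpleGraph.Walk.eq_of_length_eq_zero h0

theorem walkWeight_le {u v : Fin n} (p : N.graph.Walk u v) :
    N.walkWeight p ≤ p.length * n ^ a := by
  have := List.sum_le_card_nsmul (p.edges.map N.weight) (n ^ a) (by
    intro x hx
    obtain ⟨e, he, rfl⟩ := List.mem_map.mp hx
    exact N.weight_le e (p.edges_subset_edgeSet he))
  simpa [walkWeight] using this

theorem le_of_hopDist_eq {t : ℕ} {u w : Fin n} {d : ℕ} (h : N.hopDist t u w = d) :
    d ≤ n * n ^ a := by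
  have hn : 0 < n := u.pos
  rw [← hopDist_min_shortestPathDiam] at h
  obtain ⟨p, hp, rfl⟩ := N.exists_walk_of_hopDist h
  refine (N.walkWeight_le p).trans (Nat.mul_le_mul_right _ ?_)
  exact hp.trans ((min_le_right _ _).trans (N.shortestPathDiam_lt hn).le)

theorem hopDist_ne_top_iff {t : ℕ} {u w : Fin n} :
    N.hopDist t u w ≠ ⊤ ↔ N.graph.dist u w ≤ t := by
  constructor
  · intro h
    obtain ⟨d, hd⟩ := ENat.ne_top_iff_exists.mp h
    obtain ⟨p, hp, -⟩ := N.exists_walk_of_hopDist hd.symm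
    exact (SimpleGraph.dist_le p).trans hp
  · intro h
    obtain ⟨p, hp⟩ := N.connected.exists_walk_length_eq_dist u w
    exact ne_top_of_le_ne_top (ENat.natCast_ne_top _)
      ((N.hopDist_antitone (hp ▸ h) u w).trans (N.hopDist_length_le p))

end Network

/-! ### Tables and their local update -/

/-- An entry of a table: the identity number of a node, its level, and a distance to it. -/
abbrev Entry : Type := ℕ × ℕ × ℕ

/-- The entries `(i, ℓ, d)` of `E` such that no entry of `E` which precedes it in the order by
distance and then by identity number has a higher level or the same identity number. -/
def entryFront (E : Set Entry) : Set Entry :=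
  {e ∈ E | ∀ e' ∈ E, toLex (e'.2.2, e'.1) < toLex (e.2.2, e.1) → e'.2.1 ≤ e.2.1 ∧ e'.1 ≠ e.1}

/-- The entries of a node's own table `E`, together with the entries of the tables `R i` of the
neighbours `i`, where the weight of the edge to `i` is added to the distance. -/
def relaxedEntries (nbrWeight : ℕ → Option ℕ) (E : Set Entry) (R : ℕ → Set Entry) : Set Entry :=
  E ∪ {e | ∃ i c d, nbrWeight i = some c ∧ (e.1, e.2.1, d) ∈ R i ∧ e.2.2 = c + d}

namespace Network

variable {n a : ℕ} (N : Network n a) (lev : Fin n → ℕ)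

theorem nbrWeight_eq_some_iff {u : Fin n} {i c : ℕ} :
    (N.localInput u).nbrWeight i = some c ↔
      ∃ x, N.id x = i ∧ N.graph.Adj u x ∧ c = N.weight s(u, x) := by
  classical
  simp only [localInput]
  by_cases h : ∃ x, N.id x = i
  · obtain ⟨x, rfl⟩ := h
    rw [N.id_injective.extend_apply]
    by_cases hx : N.graph.Adj u x
    · simp only [hx, if_true, Option.some.injEq]
      constructor
      · rintro rfl
        exact ⟨x, rfl, hx, rfl⟩
      · rintro ⟨y, hy, -, rfl⟩
        rw [N.id_injective hy]
    · simp only [hx, if_false, reduceCtorEq, false_iff, not_exists]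
      rintro y ⟨hy, hadj, -⟩
      exact hx (N.id_injective hy ▸ hadj)
  · rw [Function.extend_apply' _ _ _ h]
    simp only [reduceCtorEq, false_iff, not_exists]
    rintro y ⟨hy, -⟩
    exact h ⟨y, hy⟩

/-- The nodes `w` are ordered by `hopDist t u w`, with ties broken by identity numbers. -/
noncomputable def key (t : ℕ) (u w : Fin n) : ℕ∞ ×ₗ ℕ := toLex (N.hopDist t u w, N.id w)

theorem key_lt_iff {t t' : ℕ} {u u' w w' : Fin n} : N.key t u w < N.key t' u' w' ↔
    N.hopDist t u w < N.hopDist t' u' w' ∨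
      N.hopDist t u w = N.hopDist t' u' w' ∧ N.id w < N.id w' :=
  Prod.Lex.toLex_lt_toLex

theorem key_injective (t : ℕ) (u : Fin n) : Function.Injective (N.key t u) := fun w w' h => by
  have := congrArg (fun x => (ofLex x).2) h
  exact N.id_injective this

theorem hopDist_le_of_key_le {t : ℕ} {u w w' : Fin n} (h : N.key t u w ≤ N.key t u w') :
    N.hopDist t u w ≤ N.hopDist t u w' := by
  rcases (Prod.Lex.toLex_le_toLex (x := (N.hopDist t u w, N.id w))).mp h with h | h
  · exact h.le
  · exact h.1.le

/-- The node `w` is in the bunch of `u` if no node which is closer to `u` has a higher level. -/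
def IsBunch (t : ℕ) (u w : Fin n) : Prop :=
  ∀ w', N.key t u w' < N.key t u w → lev w' ≤ lev w

/-- The bunch of `u` for walks with at most `t` edges, as a set of entries. -/
def table (t : ℕ) (u : Fin n) : Set Entry :=
  {e | ∃ (w : Fin n) (d : ℕ), N.hopDist t u w = d ∧ N.IsBunch lev t u w ∧
    e = (N.id w, lev w, d)}

variable {lev}

theorem mem_table_iff {t : ℕ} {u w : Fin n} {l d : ℕ} : (N.id w, l, d) ∈ N.table lev t u ↔
    N.hopDist t u w = d ∧ N.IsBunch lev t u w ∧ l = lev w := by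
  constructor
  · rintro ⟨w', d', h1, h2, h3⟩
    simp only [Prod.mk.injEq] at h3
    obtain ⟨h3, rfl, rfl⟩ := h3
    obtain rfl := N.id_injective h3
    exact ⟨h1, h2, rfl⟩
  · rintro ⟨h1, h2, rfl⟩
    exact ⟨w, d, h1, h2, rfl⟩

/-- The closest node of level at least `i` is in the bunch. -/
theorem exists_isBunch_of_le {t : ℕ} (u : Fin n) {w : Fin n} {i : ℕ} (hw : i ≤ lev w) :
    ∃ w', i ≤ lev w' ∧ N.key t u w' ≤ N.key t u w ∧ N.IsBunch lev t u w' := by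
  obtain ⟨w', hw', hmin⟩ := Finset.exists_min_image (Finset.univ.filter fun w => i ≤ lev w)
    (N.key t u) ⟨w, by simpa using hw⟩
  simp only [Finset.mem_filter, Finset.mem_univ, true_and] at hw' hmin
  refine ⟨w', hw', hmin w hw, fun v hv => ?_⟩
  by_contra hlt
  exact absurd (hmin v (by omega)) (not_le.mpr hv)

theorem exists_isBunch_of_not {t : ℕ} {u w : Fin n} (h : ¬ N.IsBunch lev t u w) :
    ∃ w', N.IsBunch lev t u w' ∧ N.key t u w' < N.key t u w ∧ lev w < lev w' := by
  simp only [IsBunch, not_forall, not_le] at h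
  obtain ⟨v, hv, hlev⟩ := h
  obtain ⟨w', h1, h2, h3⟩ := N.exists_isBunch_of_le (t := t) u (Nat.succ_le_of_lt hlev)
  exact ⟨w', h3, h2.trans_lt hv, h1⟩

/-- An earlier bunch contains the nodes whose distance has not changed since. -/
theorem isBunch_of_hopDist_succ_eq {t : ℕ} {u w : Fin n}
    (h : N.hopDist (t + 1) u w = N.hopDist t u w) (hb : N.IsBunch lev (t + 1) u w) :
    N.IsBunch lev t u w := by
  refine fun w' hw' => hb w' ?_
  rw [key_lt_iff] at hw' ⊢
  rw [h]
  have := N.hopDist_succ_le t u w'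
  rcases hw' with hw' | ⟨h1, h2⟩
  · exact Or.inl (this.trans_lt hw')
  · rcases this.lt_or_eq with h3 | h3
    · exact Or.inl (h1 ▸ h3)
    · exact Or.inr ⟨h3.trans h1, h2⟩

/-- Bunches are closed under passing to the next node of a shortest walk. -/
theorem isBunch_of_adj {t : ℕ} {u x w : Fin n} (hx : N.graph.Adj u x)
    (h : N.hopDist (t + 1) u w = (N.weight s(u, x) : ℕ∞) + N.hopDist t x w)
    (hb : N.IsBunch lev (t + 1) u w) : N.IsBunch lev t x w := by
  refine fun w' hw' => hb w' ?_
  rw [key_lt_iff] at hw' ⊢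
  rw [h]
  have := N.hopDist_succ_le_of_adj t hx w'
  rcases hw' with hw' | ⟨h1, h2⟩
  · refine Or.inl (this.trans_lt ?_)
    exact (ENat.add_lt_add_iff_left (ENat.natCast_ne_top _)).mpr hw'
  · rw [← h1]
    rcases this.lt_or_eq with h3 | h3
    · exact Or.inl h3
    · exact Or.inr ⟨h3, h2⟩

theorem table_zero (u : Fin n) : N.table lev 0 u = {(N.id u, lev u, 0)} := by
  ext e
  constructor
  · rintro ⟨w, d, h1, -, rfl⟩
    by_cases huw : u = w
    · subst huw
      simp only [hopDist, if_true] at h1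
      have : d = 0 := by exact_mod_cast h1.symm
      simp [this]
    · simp [hopDist, huw] at h1
  · rintro rfl
    rw [mem_table_iff]
    refine ⟨by simp [hopDist], fun w' hw' => ?_, rfl⟩
    by_cases huw : u = w'
    · rw [huw]
    · simp [key_lt_iff, hopDist, huw] at hw'

section Relax

variable {t : ℕ} {u : Fin n} {R : ℕ → Set Entry}
  (hR : ∀ x, N.graph.Adj u x → R (N.id x) = N.table lev t x)

include hR

/-- No relaxed entry underestimates a distance. -/
theorem hopDist_le_of_mem_relaxedEntries {e : Entry}
    (he : e ∈ relaxedEntries (N.localInput u).nbrWeight (N.table lev t u) R) :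
    ∃ w d, e = (N.id w, lev w, d) ∧ N.hopDist (t + 1) u w ≤ (d : ℕ) := by
  rcases he with ⟨w, d, h1, -, rfl⟩ | ⟨i, c, d, hi, he, hc⟩
  · exact ⟨w, d, rfl, h1 ▸ N.hopDist_succ_le t u w⟩
  · obtain ⟨x, rfl, hx, rfl⟩ := N.nbrWeight_eq_some_iff.mp hi
    rw [hR x hx] at he
    obtain ⟨w, d', h1, -, h2⟩ := he
    obtain ⟨e1, e2, e3⟩ := e
    simp only [Prod.mk.injEq] at h2 hc
    obtain ⟨rfl, rfl, rfl⟩ := h2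
    refine ⟨w, e3, rfl, (N.hopDist_succ_le_of_adj t hx w).trans ?_⟩
    rw [h1, hc]
    push_cast
    exact le_rfl

/-- The entries that belong to the next table arrive with their correct distances. -/
theorem mem_relaxedEntries_of_isBunch {w : Fin n} {d : ℕ} (hd : N.hopDist (t + 1) u w = d)
    (hb : N.IsBunch lev (t + 1) u w) :
    (N.id w, lev w, d) ∈ relaxedEntries (N.localInput u).nbrWeight (N.table lev t u) R := by
  rcases N.hopDist_succ_cases t u w with h | ⟨x, hx, h⟩
  · exact Or.inl ⟨w, d, h ▸ hd, N.isBunch_of_hopDist_succ_eq h hb, rfl⟩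
  · have hne : N.hopDist t x w ≠ ⊤ := by
      intro htop
      rw [hd, htop] at h
      simp at h
    obtain ⟨e, he⟩ := ENat.ne_top_iff_exists.mp hne
    refine Or.inr ⟨N.id x, N.weight s(u, x), e, N.nbrWeight_eq_some_iff.mpr ⟨x, rfl, hx, rfl⟩,
      ?_, ?_⟩
    · rw [hR x hx]
      exact ⟨w, e, he.symm, N.isBunch_of_adj hx h hb, rfl⟩
    · rw [hd, ← he] at h
      exact_mod_cast h

/-- The tables for walks with at most `t + 1` edges can be computed locally from the tables for
walks with at most `t` edges: an entry that has been discarded at a neighbour is discarded here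
as well. -/
theorem table_succ : N.table lev (t + 1) u =
    entryFront (relaxedEntries (N.localInput u).nbrWeight (N.table lev t u) R) := by
  ext e
  constructor
  · rintro ⟨w, d, hd, hb, rfl⟩
    refine ⟨N.mem_relaxedEntries_of_isBunch hR hd hb, fun e' he' hlt => ?_⟩
    obtain ⟨w', d', rfl, hle⟩ := N.hopDist_le_of_mem_relaxedEntries hR he'
    rw [Prod.Lex.toLex_lt_toLex] at hlt
    simp only at hlt ⊢
    constructor
    · refine hb w' (N.key_lt_iff.mpr ?_)
      rw [hd]
      rcases hlt with hlt | ⟨rfl, hid⟩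
      · exact Or.inl (hle.trans_lt (by exact_mod_cast hlt))
      · rcases hle.lt_or_eq with h | h
        · exact Or.inl h
        · exact Or.inr ⟨h, hid⟩
    · intro heq
      obtain rfl := N.id_injective heq
      rw [hd] at hle
      have : d ≤ d' := by exact_mod_cast hle
      omega
  · rintro ⟨he, hfront⟩
    obtain ⟨w, d, rfl, hle⟩ := N.hopDist_le_of_mem_relaxedEntries hR he
    obtain ⟨d₀, hd₀⟩ := ENat.ne_top_iff_exists.mp
      (ne_top_of_le_ne_top (ENat.natCast_ne_top _) hle)
    have hle' : d₀ ≤ d := by rw [← hd₀] at hle; exact_mod_cast hle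
    have hb : N.IsBunch lev (t + 1) u w := by
      by_contra hnb
      obtain ⟨w', hb', hkey, hlev⟩ := N.exists_isBunch_of_not hnb
      obtain ⟨d', hd'⟩ := ENat.ne_top_iff_exists.mp
        (ne_top_of_le_ne_top (ENat.natCast_ne_top _)
          ((N.hopDist_le_of_key_le hkey.le).trans hle))
      have := (hfront _ (N.mem_relaxedEntries_of_isBunch hR hd'.symm hb') ?_).1
      · simp only at this
        omega
      · rw [key_lt_iff, ← hd', ← hd₀] at hkey
        rw [Prod.Lex.toLex_lt_toLex]
        simp only [Nat.cast_lt, Nat.cast_inj] at hkey ⊢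
        omega
    have hmem := N.mem_relaxedEntries_of_isBunch hR hd₀.symm hb
    have hdd : d₀ = d := by
      by_contra hne
      refine (hfront _ hmem ?_).2 rfl
      rw [Prod.Lex.toLex_lt_toLex]
      exact Or.inl (by simp only; omega)
    exact ⟨w, d, hdd ▸ hd₀.symm, hb, rfl⟩

end Relax

theorem table_min_shortestPathDiam (t : ℕ) (u : Fin n) :
    N.table lev (min t N.shortestPathDiam) u = N.table lev t u := by
  simp only [table, IsBunch, key, hopDist_min_shortestPathDiam]

/-! ### Detecting that all tables are final -/

variable (lev)

/-- The table of `u` does not change in step `t`. -/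
def Quiet (t : ℕ) (u : Fin n) : Prop := N.table lev (t + 1) u = N.table lev t u

open Classical in
/-- The time after the last change of a table that `u` has heard of by time `t`, if news travels
one edge per step. -/
noncomputable def lastChange : ℕ → Fin n → ℕ
  | 0, _ => 0
  | t + 1, u => if N.Quiet lev t u then
      max (lastChange t u) (Finset.univ.sup fun x => if N.graph.Adj u x then lastChange t x else 0)
    else t + 1

variable {lev}

theorem quiet_of_shortestPathDiam_le {t : ℕ} (h : N.shortestPathDiam ≤ t) (u : Fin n) :
    N.Quiet lev t u := by
  rw [Quiet, ← table_min_shortestPathDiam, ← N.table_min_shortestPathDiam t]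
  congr 1
  omega

theorem table_eq_of_quiet {s t : ℕ} (h : ∀ u, N.Quiet lev s u) (hst : s ≤ t) (u : Fin n) :
    N.table lev t u = N.table lev s u := by
  induction t, hst using Nat.le_induction generalizing u with
  | base => rfl
  | succ t hst ih =>
    have hext : ∀ x, Function.extend N.id (N.table lev s) (fun _ => ∅) (N.id x) =
        N.table lev s x := fun x => N.id_injective.extend_apply _ _ _
    rw [N.table_succ (R := Function.extend N.id (N.table lev s) fun _ => ∅)
      (fun x _ => (hext x).trans (ih x).symm), ih u, ← N.table_succ (fun x _ => hext x)]
    exact h u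

theorem quiet_of_le {s t : ℕ} (h : ∀ u, N.Quiet lev s u) (hst : s ≤ t) (u : Fin n) :
    N.Quiet lev t u := by
  rw [Quiet, N.table_eq_of_quiet h hst, N.table_eq_of_quiet h (hst.trans t.le_succ)]

theorem lastChange_le_self (t : ℕ) (u : Fin n) : N.lastChange lev t u ≤ t := by
  induction t generalizing u with
  | zero => simp [lastChange]
  | succ t ih =>
    rw [lastChange]
    split_ifs
    · refine max_le ((ih u).trans t.le_succ) (Finset.sup_le fun x _ => ?_)
      split_ifs
      · exact (ih x).trans t.le_succ
      · exact Nat.zero_le _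
    · exact le_rfl

theorem lastChange_le_of_quiet {s : ℕ} (h : ∀ u, N.Quiet lev s u) (t : ℕ) (u : Fin n) :
    N.lastChange lev t u ≤ s := by
  rcases le_total t s with hts | hst
  · exact (N.lastChange_le_self t u).trans hts
  · induction t, hst using Nat.le_induction generalizing u with
    | base => exact N.lastChange_le_self s u
    | succ t hst ih =>
      rw [lastChange, if_pos (N.quiet_of_le h hst u)]
      refine max_le (ih u) (Finset.sup_le fun x _ => ?_)
      split_ifs
      · exact ih x
      · exact Nat.zero_le _

theorem lastChange_le_succ (t : ℕ) (u : Fin n) :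
    N.lastChange lev t u ≤ N.lastChange lev (t + 1) u := by
  rw [lastChange]
  split_ifs
  · exact le_max_left _ _
  · exact (N.lastChange_le_self t u).trans t.le_succ

theorem lastChange_le_succ_of_adj (t : ℕ) {u x : Fin n} (h : N.graph.Adj u x) :
    N.lastChange lev t x ≤ N.lastChange lev (t + 1) u := by
  rw [lastChange]
  split_ifs
  · refine le_max_of_le_right ?_
    refine le_trans ?_ (Finset.le_sup (Finset.mem_univ x))
    simp [h]
  · exact (N.lastChange_le_self t x).trans t.le_succ

theorem lastChange_le_add_length {u x : Fin n} (p : N.graph.Walk u x) (t : ℕ) :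
    N.lastChange lev t x ≤ N.lastChange lev (t + p.length) u := by
  induction p with
  | nil => simp
  | cons h p ih => exact ih.trans (N.lastChange_le_succ_of_adj _ h)

/-- A node knows about all changes in a ball whose radius is the time that has passed since. -/
theorem quiet_of_lastChange_le {s t : ℕ} {u x : Fin n} (h : N.lastChange lev t u ≤ s)
    (hx : s + 1 + N.graph.dist u x ≤ t) : N.Quiet lev s x := by
  by_contra hq
  obtain ⟨p, hp⟩ := N.connected.exists_walk_length_eq_dist u x
  have h1 : N.lastChange lev (s + 1) x = s + 1 := by rw [lastChange, if_neg hq]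
  have h2 := N.lastChange_le_add_length (lev := lev) p (s + 1)
  have h3 : N.lastChange lev (s + 1 + p.length) u ≤ N.lastChange lev t u :=
    monotone_nat_of_le_succ (f := fun t => N.lastChange lev t u)
      (fun t => N.lastChange_le_succ t u) (hp ▸ hx)
  omega

variable (lev) in
/-- Among the nodes within `t` edges of `u`, the node `z` has the highest level. -/
def IsTop (t : ℕ) (u z : Fin n) : Prop :=
  N.hopDist t u z ≠ ⊤ ∧ ∀ w, N.hopDist t u w ≠ ⊤ → lev w ≤ lev z

theorem exists_isTop (t : ℕ) (u : Fin n) : ∃ z, N.IsTop lev t u z := by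
  classical
  obtain ⟨z, hz, hmax⟩ := Finset.exists_max_image
    (Finset.univ.filter fun w => N.hopDist t u w ≠ ⊤) lev ⟨u, by simp [hopDist_self]⟩
  simp only [Finset.mem_filter, Finset.mem_univ, true_and] at hz hmax
  exact ⟨z, hz, hmax⟩

theorem IsTop.isBunch {t : ℕ} {u z : Fin n} (h : N.IsTop lev t u z) : N.IsBunch lev t u z :=
  fun w hw => h.2 w (ne_top_of_le_ne_top h.1 (N.hopDist_le_of_key_le hw.le))

theorem IsTop.hopDist_ne_top_of_quiet {t : ℕ} {u z : Fin n} (h : N.IsTop lev (t + 1) u z)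
    (hq : N.Quiet lev t u) : N.hopDist t u z ≠ ⊤ := by
  obtain ⟨d, hd⟩ := ENat.ne_top_iff_exists.mp h.1
  have hmem : (N.id z, lev z, d) ∈ N.table lev (t + 1) u :=
    N.mem_table_iff.mpr ⟨hd.symm, h.isBunch, rfl⟩
  rw [hq, mem_table_iff] at hmem
  rw [hmem.1]
  exact ENat.natCast_ne_top _

/-- Neighbours whose tables do not change know the same nodes of the highest level. -/
theorem IsTop.of_adj {t : ℕ} {x y z : Fin n} (hxy : N.graph.Adj x y) (hx : N.Quiet lev t x)
    (hy : N.Quiet lev t y) (h : N.IsTop lev t x z) : N.IsTop lev t y z := by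
  have hadj : ∀ {x y : Fin n}, N.graph.Adj x y → ∀ {w}, N.hopDist t x w ≠ ⊤ →
      N.hopDist (t + 1) y w ≠ ⊤ := fun {x y} hxy w hw => by
    rw [hopDist_ne_top_iff] at hw ⊢
    have h1 := N.connected.dist_triangle (u := y) (v := x) (w := w)
    have h2 := SimpleGraph.dist_eq_one_iff_adj.mpr hxy.symm
    omega
  obtain ⟨z', hz'⟩ := N.exists_isTop (lev := lev) (t + 1) y
  obtain ⟨z'', hz''⟩ := N.exists_isTop (lev := lev) (t + 1) x
  have h1 : lev z'' ≤ lev z := h.2 _ (hz''.hopDist_ne_top_of_quiet N hx)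
  have h2 : lev z' ≤ lev z'' := hz''.2 _ (hadj hxy.symm (hz'.hopDist_ne_top_of_quiet N hy))
  have htop : N.IsTop lev (t + 1) y z :=
    ⟨hadj hxy h.1, fun w hw => (hz'.2 w hw).trans (h2.trans h1)⟩
  refine ⟨htop.hopDist_ne_top_of_quiet N hy, fun w hw => htop.2 w ?_⟩
  exact ne_top_of_le_ne_top hw (N.hopDist_succ_le t y w)

/-- If all nodes within `2 s + 1` edges of `u` are quiet at time `s`, then all of them know the
same node `z` of the highest level, which is within `s` edges of each of them.  Hence there are no
nodes at `2 s + 1` edges from `u`, and these nodes are the whole network. -/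
theorem quiet_of_forall_dist_le {s : ℕ} {u : Fin n}
    (h : ∀ x, N.graph.dist u x ≤ 2 * s + 1 → N.Quiet lev s x) (x : Fin n) : N.Quiet lev s x := by
  obtain ⟨z, hz⟩ := N.exists_isTop (lev := lev) s u
  have key : ∀ {v x : Fin n} (_ : N.graph.Walk v x), N.graph.dist u v ≤ 2 * s ∧ N.IsTop lev s v z →
      N.graph.dist u x ≤ 2 * s ∧ N.IsTop lev s x z := by
    intro v x p
    induction p with
    | nil => exact fun h => h
    | @cons v y x hvy p ih =>
      rintro ⟨hv, htop⟩
      apply ih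
      have h1 := N.connected.dist_triangle (u := u) (v := v) (w := y)
      have h2 := SimpleGraph.dist_eq_one_iff_adj.mpr hvy
      have hy : N.IsTop lev s y z := htop.of_adj N hvy (h v (by omega)) (h y (by omega))
      refine ⟨?_, hy⟩
      have h3 := N.hopDist_ne_top_iff.mp hy.1
      have h4 := N.hopDist_ne_top_iff.mp hz.1
      have h5 := N.connected.dist_triangle (u := u) (v := z) (w := y)
      rw [SimpleGraph.dist_comm (u := z)] at h5
      omega
  obtain ⟨p⟩ := N.connected.preconnected u x
  exact h x (((key p) ⟨by simp, hz⟩).1.trans (by omega))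

/-- The condition under which `u` stops at time `t`. -/
def Settled (lev : Fin n → ℕ) (t : ℕ) (u : Fin n) : Prop := 3 * N.lastChange lev t u + 2 ≤ t

theorem quiet_of_settled {t : ℕ} {u : Fin n} (h : N.Settled lev t u) (x : Fin n) :
    N.Quiet lev (N.lastChange lev t u) x :=
  N.quiet_of_forall_dist_le (u := u) (fun y hy => N.quiet_of_lastChange_le (u := u) le_rfl
    (by rw [Settled] at h; omega)) x

/-- All nodes stop at the same time. -/
theorem settled_of_settled {t : ℕ} {u : Fin n} (h : N.Settled lev t u) (v : Fin n) :
    N.Settled lev t v := by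
  have := N.lastChange_le_of_quiet (N.quiet_of_settled h) t v
  rw [Settled] at h ⊢
  omega

theorem settled_of_shortestPathDiam_le {t : ℕ} (h : 3 * N.shortestPathDiam + 2 ≤ t) (u : Fin n) :
    N.Settled lev t u := by
  have := N.lastChange_le_of_quiet (lev := lev) (N.quiet_of_shortestPathDiam_le le_rfl) t u
  rw [Settled]
  omega

/-- When the nodes stop, all tables are final. -/
theorem table_eq_of_settled {t : ℕ} {u : Fin n} (h : N.Settled lev t u) (v : Fin n) :
    N.table lev t v = N.table lev N.shortestPathDiam v := by
  have hq := N.quiet_of_settled h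
  have h1 := N.table_eq_of_quiet hq (N.lastChange_le_self t u) v
  have h2 := N.table_eq_of_quiet hq (le_max_left _ N.shortestPathDiam) v
  rw [h1, ← h2, ← table_min_shortestPathDiam, min_eq_right (le_max_right _ _)]

end Network

/-! ### Size and stretch of the sketches -/

/-- The levels behave on `F` as those of independent random nodes: a set with at least `Λ * 2 ^ i`
nodes contains a node of level at least `i`, and a set with at most twice as many nodes contains
at most `5 * Λ` such nodes. -/
def WellSpread {n : ℕ} (lev : Fin n → ℕ) (Λ i : ℕ) (F : Finset (Fin n)) : Prop :=
  (Λ * 2 ^ i ≤ F.card → ∃ w ∈ F, i ≤ lev w) ∧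
    (F.card ≤ 2 * (Λ * 2 ^ i) → (F.filter fun w => i ≤ lev w).card ≤ 5 * Λ)

/-- The distance estimate computed from two tables: the minimum length of a detour through a node
that occurs in both of them. -/
noncomputable def tableEstimate (E E' : Set Entry) : ℕ :=
  sInf {x | ∃ i l d l' d', (i, l, d) ∈ E ∧ (i, l', d') ∈ E' ∧ d + d' = x}

namespace Network

open Classical

variable {n a : ℕ} (N : Network n a) {lev : Fin n → ℕ} {Λ k : ℕ}

/-- The nodes which precede `v` in the order of the nodes by `hopDist t u`. -/
noncomputable def before (t : ℕ) (u v : Fin n) : Finset (Fin n) :=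
  Finset.univ.filter fun w => N.key t u w < N.key t u v

/-- The nodes which are strictly closer to `u` than `v` is. -/
noncomputable def closer (u v : Fin n) : Finset (Fin n) :=
  Finset.univ.filter fun w => N.dist u w < N.dist u v

/-- The bunch has few nodes of level `i`: the set of the nodes before the last one of them has no
node of a higher level, so it is small, and a small set has few nodes of level at least `i`. -/
theorem card_isBunch_level_le {t i : ℕ} {u : Fin n}
    (hi : ∀ v, WellSpread lev Λ i (N.before t u v))
    (hi' : n < Λ * 2 ^ (i + 1) ∨ ∀ v, WellSpread lev Λ (i + 1) (N.before t u v)) :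
    (Finset.univ.filter fun w => N.IsBunch lev t u w ∧ lev w = i).card ≤ 5 * Λ + 1 := by
  set X := Finset.univ.filter fun w => N.IsBunch lev t u w ∧ lev w = i with hX
  rcases X.eq_empty_or_nonempty with h0 | hne
  · simp [h0]
  obtain ⟨v, hv, hmax⟩ := Finset.exists_max_image X (N.key t u) hne
  -- No node before the last node `v` of `X` has a level above `i`, so there are few of them.
  have hvb : N.IsBunch lev t u v ∧ lev v = i := by simpa [hX] using hv
  have hcard : (N.before t u v).card < Λ * 2 ^ (i + 1) := by
    rcases hi' with hi' | hi'
    · exact (Finset.card_le_univ _).trans_lt (by simpa using hi')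
    · by_contra hge
      obtain ⟨w, hw, hlev⟩ := (hi' v).1 (not_lt.mp hge)
      have := hvb.1 w (by simpa [before] using hw)
      omega
  have hfew := (hi v).2 (by rw [pow_succ, ← mul_assoc] at hcard; omega)
  have hsub : X ⊆ insert v ((N.before t u v).filter fun w => i ≤ lev w) := by
    intro w hw
    have hwb : N.IsBunch lev t u w ∧ lev w = i := by simpa [hX] using hw
    rcases (hmax w hw).lt_or_eq with h | h
    · simp [before, h, hwb.2]
    · simp [N.key_injective t u h]
  calc X.card ≤ _ := Finset.card_le_card hsub
    _ ≤ _ := Finset.card_insert_le _ _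
    _ ≤ _ := by omega

theorem card_isBunch_le {t : ℕ} {u : Fin n} (hlev : ∀ w, lev w ≤ k) (hk : n < Λ * 2 ^ (k + 1))
    (h : ∀ i ≤ k, ∀ v, WellSpread lev Λ i (N.before t u v)) :
    (Finset.univ.filter fun w => N.IsBunch lev t u w).card ≤ (k + 1) * (5 * Λ + 1) := by
  rw [Finset.card_eq_sum_card_fiberwise (f := lev) (t := Finset.range (k + 1))
    (fun w _ => by simpa using Nat.lt_succ_of_le (hlev w))]
  refine (Finset.sum_le_card_nsmul _ _ (5 * Λ + 1) fun i hi => ?_).trans_eq (by simp)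
  rw [Finset.mem_range] at hi
  rw [Finset.filter_filter]
  refine N.card_isBunch_level_le (h i (by omega)) ?_
  rcases (Nat.lt_succ_iff.mp hi).lt_or_eq with hik | rfl
  · exact Or.inr (h (i + 1) hik)
  · exact Or.inl hk

theorem table_subset_image (t : ℕ) (u : Fin n) : N.table lev t u ⊆
    ((Finset.univ.filter fun w => N.IsBunch lev t u w).image
      fun w => ((N.id w, lev w, (N.hopDist t u w).toNat) : Entry) : Finset Entry) := by
  rintro e ⟨w, d, hd, hb, rfl⟩
  simp only [Finset.coe_image, Set.mem_image, Finset.coe_filter, Finset.mem_univ, true_and,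
    Set.mem_ofPred_eq]
  exact ⟨w, hb, by simp [hd]⟩

theorem table_finite (t : ℕ) (u : Fin n) : (N.table lev t u).Finite :=
  (Finset.finite_toSet _).subset (N.table_subset_image t u)

theorem ncard_table_le {t : ℕ} {u : Fin n} (hlev : ∀ w, lev w ≤ k) (hk : n < Λ * 2 ^ (k + 1))
    (h : ∀ i ≤ k, ∀ v, WellSpread lev Λ i (N.before t u v)) :
    (N.table lev t u).ncard ≤ (k + 1) * (5 * Λ + 1) := by
  refine (Set.ncard_le_ncard (N.table_subset_image t u) (Finset.finite_toSet _)).trans ?_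
  rw [Set.ncard_coe_finset]
  exact Finset.card_image_le.trans (N.card_isBunch_le hlev hk h)

theorem key_le_key_dist {u w w' : Fin n} (h : N.key N.shortestPathDiam u w ≤
    N.key N.shortestPathDiam u w') : N.dist u w ≤ N.dist u w' := by
  have := N.hopDist_le_of_key_le h
  rw [N.hopDist_eq_dist le_rfl, N.hopDist_eq_dist le_rfl] at this
  exact_mod_cast this

/-- If a node of level at least `k - j` is within distance `x * d(u,v)` of `u`, take the closest
one.  If it is not in the bunch of `v`, then a node of a higher level is within distance
`(x + 1) * d(u,v)` of `v`, and the argument can be repeated with `u` and `v` exchanged. -/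
theorem exists_isBunch_isBunch (hlev : ∀ w, lev w ≤ k) (j : ℕ) {u v : Fin n} {x : ℕ}
    (hw : ∃ w, k ≤ lev w + j ∧ N.dist u w ≤ x * N.dist u v) :
    ∃ w, N.IsBunch lev N.shortestPathDiam u w ∧ N.IsBunch lev N.shortestPathDiam v w ∧
      N.dist u w + N.dist w v ≤ (2 * (x + j) + 1) * N.dist u v := by
  induction j generalizing u v x with
  | zero =>
    obtain ⟨w₀, hk, hd₀⟩ := hw
    obtain ⟨w, hw, hkey, hb⟩ := N.exists_isBunch_of_le (t := N.shortestPathDiam) u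
      (show k ≤ lev w₀ by omega)
    have hd := (N.key_le_key_dist hkey).trans hd₀
    refine ⟨w, hb, fun w' _ => (hlev w').trans hw, ?_⟩
    have := N.dist_triangle w u v
    rw [N.dist_comm w u] at this
    linarith
  | succ j ih =>
    obtain ⟨w₀, hk, hd₀⟩ := hw
    obtain ⟨w, hw, hkey, hb⟩ := N.exists_isBunch_of_le (t := N.shortestPathDiam) u
      (show k - (j + 1) ≤ lev w₀ by omega)
    have hd := (N.key_le_key_dist hkey).trans hd₀
    have htri := N.dist_triangle w u v
    rw [N.dist_comm w u] at htri
    by_cases hbv : N.IsBunch lev N.shortestPathDiam v w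
    · refine ⟨w, hb, hbv, ?_⟩
      have : 0 ≤ j * N.dist u v := Nat.zero_le _
      linarith
    · obtain ⟨w', -, hkey', hlt⟩ := N.exists_isBunch_of_not hbv
      have hd' := N.key_le_key_dist hkey'.le
      rw [N.dist_comm v w] at hd'
      obtain ⟨w'', h1, h2, h3⟩ := ih (u := v) (v := u) (x := x + 1)
        ⟨w', by omega, by rw [N.dist_comm v u]; linarith⟩
      refine ⟨w'', h2, h1, ?_⟩
      rw [N.dist_comm v w'', N.dist_comm w'' u, N.dist_comm v u] at h3
      linarith

theorem tableEstimate_le {u v w : Fin n} (hu : N.IsBunch lev N.shortestPathDiam u w)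
    (hv : N.IsBunch lev N.shortestPathDiam v w) :
    tableEstimate (N.table lev N.shortestPathDiam u) (N.table lev N.shortestPathDiam v) ≤
      N.dist u w + N.dist w v := by
  refine Nat.sInf_le ⟨N.id w, lev w, N.dist u w, lev w, N.dist w v, ?_, ?_, rfl⟩
  · exact N.mem_table_iff.mpr ⟨N.hopDist_eq_dist le_rfl u w, hu, rfl⟩
  · rw [N.dist_comm]
    exact N.mem_table_iff.mpr ⟨N.hopDist_eq_dist le_rfl v w, hv, rfl⟩

theorem dist_le_tableEstimate (hlev : ∀ w, lev w ≤ k) (u v : Fin n) :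
    N.dist u v ≤
      tableEstimate (N.table lev N.shortestPathDiam u) (N.table lev N.shortestPathDiam v) := by
  obtain ⟨w, hu, hv, -⟩ := N.exists_isBunch_isBunch hlev k (u := u) (v := v) (x := 1)
    ⟨u, by omega, by simp [dist_self]⟩
  refine le_csInf ⟨_, N.id w, lev w, N.dist u w, lev w, N.dist v w,
    N.mem_table_iff.mpr ⟨N.hopDist_eq_dist le_rfl u w, hu, rfl⟩,
    N.mem_table_iff.mpr ⟨N.hopDist_eq_dist le_rfl v w, hv, rfl⟩, rfl⟩ ?_
  rintro x ⟨i, l, d, l', d', ⟨w, e, h1, -, h2⟩, hmem, rfl⟩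
  simp only [Prod.mk.injEq] at h2
  obtain ⟨rfl, rfl, rfl⟩ := h2
  have h3 := (N.mem_table_iff.mp hmem).1
  rw [N.hopDist_eq_dist le_rfl] at h1 h3
  have h1' : N.dist u w = d := by exact_mod_cast h1
  have h3' : N.dist v w = d' := by exact_mod_cast h3
  rw [← h1', ← h3', N.dist_comm v w]
  exact N.dist_triangle u w v

/-- If the ball around `u` that does not reach `v` has `m` nodes, then it contains a node of level
about `log₂ (m / Λ)`, and from there at most `log₂ (n / m) + 1` levels remain. -/
theorem isGracefullyDegrading_tableEstimate (hΛ : 0 < Λ) (hk : k = Nat.log 2 (n / Λ))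
    (hlev : ∀ w, lev w ≤ k) (h : ∀ i ≤ k, ∀ u v, WellSpread lev Λ i (N.closer u v))
    {C : ℝ} (hC : 5 ≤ C) :
    N.IsGracefullyDegrading (fun u v => tableEstimate (N.table lev N.shortestPathDiam u)
      (N.table lev N.shortestPathDiam v)) (fun ε => C * (1 + Real.log (1 / ε))) := by
  refine ⟨N.dist_le_tableEstimate hlev, fun ε hε u v hfar =>
    ⟨N.dist_le_tableEstimate hlev u v, ?_⟩⟩
  have hn : 0 < n := u.pos
  have hcard : {w | N.dist u w < N.dist u v}.ncard = (N.closer u v).card := by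
    rw [← Set.ncard_coe_finset]
    congr 1
    ext w
    simp [closer]
  set m := (N.closer u v).card with hm
  have hmn : m ≤ n := by simpa using Finset.card_le_univ (N.closer u v)
  rw [IsFar, hcard] at hfar
  set i := Nat.log 2 (m / Λ) with hi
  have hik : i ≤ k := by
    rw [hi, hk]
    exact Nat.log_mono_right (Nat.div_le_div_right hmn)
  have hstart : ∃ w, k ≤ lev w + (k - i) ∧ N.dist u w ≤ 1 * N.dist u v := by
    rcases Nat.eq_zero_or_pos i with h0 | hpos
    · exact ⟨u, by omega, by simp [dist_self]⟩
    · have hne : m / Λ ≠ 0 := by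
        intro h0
        simp [hi, h0] at hpos
      have hle : Λ * 2 ^ i ≤ m := by
        rw [mul_comm]
        exact (Nat.le_div_iff_mul_le hΛ).mp (Nat.pow_log_le_self 2 hne)
      obtain ⟨w, hw, hlw⟩ := (h i hik u v).1 hle
      simp only [closer, Finset.mem_filter] at hw
      exact ⟨w, by omega, by rw [one_mul]; exact hw.2.le⟩
  obtain ⟨w, hu, hv, hle⟩ := N.exists_isBunch_isBunch hlev (k - i) hstart
  have hest := (N.tableEstimate_le hu hv).trans hle
  have hpow : 2 ^ (k - i) * m ≤ 2 * n := by
    have hlt : m < Λ * 2 ^ (i + 1) := by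
      rw [mul_comm]
      exact (Nat.div_lt_iff_lt_mul hΛ).mp (Nat.lt_pow_succ_log_self (by norm_num) _)
    by_cases h0 : n / Λ = 0
    · have : k = 0 := by simp [hk, h0]
      simp only [this, Nat.zero_sub, pow_zero, one_mul]
      omega
    · have hle : Λ * 2 ^ k ≤ n := by
        rw [mul_comm, hk]
        exact (Nat.le_div_iff_mul_le hΛ).mp (Nat.pow_log_le_self 2 h0)
      calc 2 ^ (k - i) * m ≤ 2 ^ (k - i) * (Λ * 2 ^ (i + 1)) := Nat.mul_le_mul_left _ hlt.le
        _ = 2 * (Λ * 2 ^ (k - i + i)) := by ring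
        _ = 2 * (Λ * 2 ^ k) := by rw [Nat.sub_add_cancel hik]
        _ ≤ 2 * n := by omega
  have hn' : (0 : ℝ) < n := by exact_mod_cast hn
  have hε0 : 0 < ε := hε.1
  have hpow' : (2 : ℝ) ^ (k - i) ≤ 2 * (1 / ε) := by
    have h1 : (2 : ℝ) ^ (k - i) * m ≤ 2 * n := by exact_mod_cast hpow
    have h2 : (2 : ℝ) ^ (k - i) * (ε * n) ≤ 2 * n :=
      (mul_le_mul_of_nonneg_left hfar (by positivity)).trans h1
    have h3 : ((2 : ℝ) ^ (k - i) * ε) * n ≤ 2 * n := by linarith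
    have h4 := le_of_mul_le_mul_right h3 hn'
    rw [mul_one_div, le_div_iff₀ hε0]
    exact h4
  have hlog : ((k - i : ℕ) : ℝ) * Real.log 2 ≤ Real.log 2 + Real.log (1 / ε) := by
    rw [← Real.log_pow, ← Real.log_mul (by norm_num) (by positivity)]
    exact Real.log_le_log (by positivity) hpow'
  have hlogε : 0 ≤ Real.log (1 / ε) :=
    Real.log_nonneg (by rw [le_div_iff₀ hε0]; linarith [hε.2])
  have hlog2 := Real.log_two_gt_d9
  have hj : ((k - i : ℕ) : ℝ) ≤ 1 + 2 * Real.log (1 / ε) := by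
    by_contra hlt
    push Not at hlt
    have := mul_lt_mul_of_pos_right hlt (show 0 < Real.log 2 by linarith)
    nlinarith
  calc ((tableEstimate (N.table lev N.shortestPathDiam u)
        (N.table lev N.shortestPathDiam v) : ℕ) : ℝ)
      ≤ ((2 * (1 + (k - i)) + 1 : ℕ) : ℝ) * N.dist u v := by exact_mod_cast hest
    _ ≤ C * (1 + Real.log (1 / ε)) * N.dist u v := by
      refine mul_le_mul_of_nonneg_right ?_ (Nat.cast_nonneg _)
      have : 5 * (1 + Real.log (1 / ε)) ≤ C * (1 + Real.log (1 / ε)) :=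
        mul_le_mul_of_nonneg_right hC (by linarith)
      rw [Nat.cast_add, Nat.cast_mul, Nat.cast_add]
      push_cast
      linarith

end Network

/-! ### Random levels -/

/-- The level of a node with the coins `x`: the number of heads before the first tail. -/
noncomputable def coinLevel (k : ℕ) (x : Fin k → Bool) : ℕ :=
  Nat.findGreatest (fun i => ∀ j : Fin k, (j : ℕ) < i → x j = true) k

theorem coinLevel_le (k : ℕ) (x : Fin k → Bool) : coinLevel k x ≤ k := Nat.findGreatest_le k

theorem le_coinLevel_iff {k i : ℕ} (hi : i ≤ k) (x : Fin k → Bool) :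
    i ≤ coinLevel k x ↔ ∀ j : Fin k, (j : ℕ) < i → x j = true := by
  constructor
  · intro h j hj
    exact Nat.findGreatest_spec (P := fun i => ∀ j : Fin k, (j : ℕ) < i → x j = true)
      (Nat.zero_le k) (by simp) j (hj.trans_le h)
  · exact fun h => Nat.le_findGreatest hi h

section

open Classical

theorem card_le_coinLevel {k i : ℕ} (hi : i ≤ k) :
    (Finset.univ.filter fun x : Fin k → Bool => i ≤ coinLevel k x).card = 2 ^ (k - i) := by
  have : (Finset.univ.filter fun x : Fin k → Bool => i ≤ coinLevel k x) =
      Fintype.piFinset fun j : Fin k => if (j : ℕ) < i then {true} else Finset.univ := by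
    ext x
    simp only [Finset.mem_filter, Finset.mem_univ, true_and, le_coinLevel_iff hi,
      Fintype.mem_piFinset]
    refine forall_congr' fun j => ?_
    split_ifs with h <;> simp [h]
  rw [this, Fintype.card_piFinset]
  have h2 : ∀ j : Fin k, (if (j : ℕ) < i then {true} else Finset.univ : Finset Bool).card =
      if (j : ℕ) < i then 1 else 2 := fun j => by split_ifs <;> simp
  rw [Finset.prod_congr rfl fun j _ => h2 j,
    Fin.prod_univ_eq_prod_range (fun j => if j < i then 1 else 2) k,
    ← Nat.sub_add_cancel hi, add_comm (k - i) i, Finset.prod_range_add]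
  rw [Finset.prod_congr rfl fun j hj => if_pos (Finset.mem_range.mp hj)]
  simp

/-- The average of a function that depends only on whether the level is at least `i`. -/
theorem sum_ite_le_coinLevel {k i : ℕ} (hi : i ≤ k) (α : ℝ) :
    ∑ x : Fin k → Bool, (if i ≤ coinLevel k x then α else 1) =
      2 ^ k * (1 + (α - 1) * (1 / 2) ^ i) := by
  have h1 : ∀ x : Fin k → Bool, (if i ≤ coinLevel k x then α else 1) =
      1 + if i ≤ coinLevel k x then α - 1 else 0 := fun x => by split_ifs <;> ring
  rw [Finset.sum_congr rfl fun x _ => h1 x, Finset.sum_add_distrib, ← Finset.sum_filter]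
  simp only [Finset.sum_const, card_le_coinLevel hi, Finset.card_univ, Fintype.card_fun,
    Fintype.card_bool, Fintype.card_fin, nsmul_eq_mul, mul_one, Nat.cast_pow, Nat.cast_ofNat]
  have : (2 : ℝ) ^ k = 2 ^ (k - i) * 2 ^ i := by rw [← pow_add, Nat.sub_add_cancel hi]
  rw [this, one_div, inv_pow]
  field_simp

variable {n k : ℕ}

theorem uniformOn_real_eq (s : Set (Fin n → Fin k → Bool)) :
    (uniformOn Set.univ : Measure (Fin n → Fin k → Bool)).real s =
      ((Finset.univ.filter fun ω => ω ∈ s).card : ℝ) / (2 ^ k) ^ n := by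
  rw [measureReal_def, uniformOn_univ, ENNReal.toReal_div]
  have : s = ((Finset.univ.filter fun ω => ω ∈ s : Finset (Fin n → Fin k → Bool)) :
    Set (Fin n → Fin k → Bool)) := by ext; simp
  conv_lhs => rw [this]
  rw [Measure.count_apply_finset]
  simp

theorem card_mul_le_sum {Ω : Type*} [Fintype Ω] (s : Finset Ω) {f : Ω → ℝ} {c : ℝ}
    (hf : ∀ ω, 0 ≤ f ω) (hs : ∀ ω ∈ s, c ≤ f ω) : s.card * c ≤ ∑ ω, f ω := by
  rw [← nsmul_eq_mul]
  exact (Finset.card_nsmul_le_sum s f c hs).trans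
    (Finset.sum_le_sum_of_subset_of_nonneg (Finset.subset_univ s) fun ω _ _ => hf ω)

/-- Markov's inequality for the product over the nodes in `F` of `α` for each node of level at
least `i`. -/
theorem uniformOn_real_mul_le {i : ℕ} (hi : i ≤ k) (F : Finset (Fin n)) {α c : ℝ} (hα : 0 ≤ α)
    {s : Set (Fin n → Fin k → Bool)}
    (hs : ∀ ω ∈ s, c ≤ ∏ w ∈ F, if i ≤ coinLevel k (ω w) then α else 1) :
    (uniformOn Set.univ : Measure (Fin n → Fin k → Bool)).real s * c ≤
      (1 + (α - 1) * (1 / 2) ^ i) ^ F.card := by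
  set φ : Fin n → (Fin k → Bool) → ℝ := fun w x =>
    if w ∈ F then (if i ≤ coinLevel k x then α else 1) else 1 with hφ
  have hφ0 : ∀ w x, 0 ≤ φ w x := fun w x => by
    simp only [hφ]
    split_ifs <;> linarith
  have hprod : ∀ ω : Fin n → Fin k → Bool,
      ∏ w, φ w (ω w) = ∏ w ∈ F, if i ≤ coinLevel k (ω w) then α else 1 := fun ω => by
    simp only [hφ]
    rw [Finset.prod_ite_mem, Finset.univ_inter]
  have hsum : ∑ ω : Fin n → Fin k → Bool, ∏ w, φ w (ω w) =
      (1 + (α - 1) * (1 / 2) ^ i) ^ F.card * (2 ^ k) ^ n := by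
    have h1 : ∀ w, ∑ x, φ w x =
        (if w ∈ F then (1 + (α - 1) * (1 / 2) ^ i) else 1) * (2 : ℝ) ^ k := fun w => by
      simp only [hφ]
      split_ifs
      · rw [sum_ite_le_coinLevel hi, mul_comm]
      · simp
    have h2 := Finset.prod_univ_sum (fun _ : Fin n => (Finset.univ : Finset (Fin k → Bool))) φ
    rw [Fintype.piFinset_univ] at h2
    rw [← h2, Finset.prod_congr rfl fun w _ => h1 w, Finset.prod_mul_distrib,
      Finset.prod_ite_mem, Finset.univ_inter]
    simp
  rw [uniformOn_real_eq, div_mul_eq_mul_div, div_le_iff₀ (by positivity), ← hsum]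
  refine card_mul_le_sum _ (fun ω => Finset.prod_nonneg fun w _ => hφ0 w _) fun ω hω => ?_
  exact (hs ω (by simpa using hω)).trans_eq (hprod ω).symm

theorem uniformOn_forall_lt_le {i Λ : ℕ} (hi : i ≤ k) {F : Finset (Fin n)}
    (hF : Λ * 2 ^ i ≤ F.card) :
    (uniformOn Set.univ : Measure (Fin n → Fin k → Bool)).real
      {ω | ¬ ∃ w ∈ F, i ≤ coinLevel k (ω w)} ≤ (1 / 2) ^ Λ := by
  have h := uniformOn_real_mul_le (c := 1) hi F le_rfl
    (s := {ω | ¬ ∃ w ∈ F, i ≤ coinLevel k (ω w)}) (fun ω hω => by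
      simp only [Set.mem_ofPred_eq, not_exists, not_and] at hω
      rw [Finset.prod_congr rfl fun w hw => if_neg (hω w hw)]
      simp)
  rw [mul_one] at h
  refine h.trans ?_
  have h0 : (0 : ℝ) ≤ 1 + (0 - 1) * (1 / 2) ^ i := by
    have : ((1 : ℝ) / 2) ^ i ≤ 1 := pow_le_one₀ (by norm_num) (by norm_num)
    linarith
  have h1 : 1 + (0 - 1) * ((1 : ℝ) / 2) ^ i ≤ Real.exp (-(1 / 2) ^ i) := by
    have := Real.add_one_le_exp (-((1 : ℝ) / 2) ^ i)
    linarith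
  have h2 : Real.exp (-1) ≤ 1 / 2 := by
    rw [Real.exp_neg, one_div]
    refine inv_anti₀ (by norm_num) ?_
    have := Real.add_one_le_exp 1
    linarith
  calc (1 + (0 - 1) * ((1 : ℝ) / 2) ^ i) ^ F.card
      ≤ (Real.exp (-(1 / 2) ^ i)) ^ F.card := pow_le_pow_left₀ h0 h1 _
    _ ≤ (Real.exp (-(1 / 2) ^ i)) ^ (Λ * 2 ^ i) :=
        pow_le_pow_of_le_one (Real.exp_pos _).le
          (Real.exp_le_one_iff.mpr (by simp)) hF
    _ = Real.exp (-1) ^ Λ := by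
        rw [← Real.exp_nat_mul, ← Real.exp_nat_mul]
        congr 1
        push_cast
        rw [one_div, inv_pow]
        field_simp
    _ ≤ (1 / 2) ^ Λ := pow_le_pow_left₀ (Real.exp_pos _).le h2 _

/-- The exponential moment of the number of nodes of level at least `i` is at most
`exp (2 * Λ) ≤ 2 ^ (4 * Λ)`. -/
theorem uniformOn_card_filter_gt_le {i Λ : ℕ} (hi : i ≤ k) {F : Finset (Fin n)}
    (hF : F.card ≤ 2 * (Λ * 2 ^ i)) :
    (uniformOn Set.univ : Measure (Fin n → Fin k → Bool)).real
      {ω | 5 * Λ < (F.filter fun w => i ≤ coinLevel k (ω w)).card} ≤ (1 / 2) ^ Λ := by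
  have h := uniformOn_real_mul_le (c := 2 ^ (5 * Λ)) hi F (show (0 : ℝ) ≤ 2 by norm_num)
    (s := {ω | 5 * Λ < (F.filter fun w => i ≤ coinLevel k (ω w)).card}) (fun ω hω => by
      rw [← Finset.prod_filter, Finset.prod_const]
      exact pow_le_pow_right₀ (by norm_num) (le_of_lt hω))
  have h1 : 1 + (2 - 1) * ((1 : ℝ) / 2) ^ i ≤ Real.exp ((1 / 2) ^ i) := by
    have := Real.add_one_le_exp (((1 : ℝ) / 2) ^ i)
    linarith
  have h2 : Real.exp 1 ≤ 4 := by
    have := Real.exp_one_lt_d9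
    linarith
  have h3 : (1 + (2 - 1) * ((1 : ℝ) / 2) ^ i) ^ F.card ≤ 2 ^ (4 * Λ) :=
    calc (1 + (2 - 1) * ((1 : ℝ) / 2) ^ i) ^ F.card
        ≤ (Real.exp ((1 / 2) ^ i)) ^ F.card := pow_le_pow_left₀ (by positivity) h1 _
      _ ≤ (Real.exp ((1 / 2) ^ i)) ^ (2 * (Λ * 2 ^ i)) :=
          pow_le_pow_right₀ (Real.one_le_exp (by positivity)) hF
      _ = Real.exp 1 ^ (2 * Λ) := by
          rw [← Real.exp_nat_mul, ← Real.exp_nat_mul]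
          congr 1
          push_cast
          rw [one_div, inv_pow]
          field_simp
      _ ≤ 4 ^ (2 * Λ) := pow_le_pow_left₀ (Real.exp_pos _).le h2 _
      _ = 2 ^ (4 * Λ) := by
          rw [show (4 : ℝ) = 2 ^ 2 by norm_num, ← pow_mul]
          congr 1
          ring
  have h4 := h.trans h3
  rw [← le_div_iff₀ (by positivity)] at h4
  refine h4.trans_eq ?_
  rw [show 5 * Λ = 4 * Λ + Λ by ring, pow_add, one_div, inv_pow]
  field_simp

theorem uniformOn_not_wellSpread_le {i Λ : ℕ} (hi : i ≤ k) (F : Finset (Fin n)) :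
    (uniformOn Set.univ : Measure (Fin n → Fin k → Bool)).real
      {ω | ¬ WellSpread (fun w => coinLevel k (ω w)) Λ i F} ≤ 2 * (1 / 2) ^ Λ := by
  have : IsProbabilityMeasure (uniformOn Set.univ : Measure (Fin n → Fin k → Bool)) :=
    isProbabilityMeasure_uniformOn Set.finite_univ Set.univ_nonempty
  have hsub : {ω : Fin n → Fin k → Bool | ¬ WellSpread (fun w => coinLevel k (ω w)) Λ i F} ⊆
      {ω | Λ * 2 ^ i ≤ F.card ∧ ¬ ∃ w ∈ F, i ≤ coinLevel k (ω w)} ∪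
      {ω | F.card ≤ 2 * (Λ * 2 ^ i) ∧
        5 * Λ < (F.filter fun w => i ≤ coinLevel k (ω w)).card} := by
    intro ω hω
    simp only [WellSpread, Set.mem_ofPred_eq, Classical.not_and_iff_not_or_not,
      Classical.not_imp, not_le] at hω
    exact hω
  refine (measureReal_mono hsub).trans ((measureReal_union_le _ _).trans ?_)
  rw [two_mul ((1 / 2 : ℝ) ^ Λ)]
  refine add_le_add ?_ ?_
  · by_cases hF : Λ * 2 ^ i ≤ F.card
    · simp only [hF, true_and]
      exact uniformOn_forall_lt_le hi hF
    · simp [hF]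
  · by_cases hF : F.card ≤ 2 * (Λ * 2 ^ i)
    · simp only [hF, true_and]
      exact uniformOn_card_filter_gt_le hi hF
    · simp [hF]

theorem one_sub_le_uniformOn_wellSpread (Λ : ℕ) (𝓕 : Finset (Finset (Fin n))) :
    1 - (𝓕.card * (k + 1)) * (2 * (1 / 2) ^ Λ) ≤
      (uniformOn Set.univ : Measure (Fin n → Fin k → Bool)).real
        {ω | ∀ F ∈ 𝓕, ∀ i ≤ k, WellSpread (fun w => coinLevel k (ω w)) Λ i F} := by
  have : IsProbabilityMeasure (uniformOn Set.univ : Measure (Fin n → Fin k → Bool)) :=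
    isProbabilityMeasure_uniformOn Set.finite_univ Set.univ_nonempty
  set s := {ω : Fin n → Fin k → Bool |
    ∀ F ∈ 𝓕, ∀ i ≤ k, WellSpread (fun w => coinLevel k (ω w)) Λ i F} with hs
  have hcompl := probReal_compl_eq_one_sub (μ := (uniformOn Set.univ : Measure _))
    (s := s) s.toFinite.measurableSet
  have hsub : sᶜ ⊆ ⋃ p ∈ 𝓕 ×ˢ Finset.range (k + 1),
      {ω : Fin n → Fin k → Bool | ¬ WellSpread (fun w => coinLevel k (ω w)) Λ p.2 p.1} := by
    intro ω hω
    simp only [hs, Set.mem_compl_iff, Set.mem_ofPred_eq, not_forall] at hω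
    obtain ⟨F, hF, i, hi, hω⟩ := hω
    simp only [Set.mem_iUnion]
    exact ⟨(F, i), by simp [hF]; omega, hω⟩
  have hle := (measureReal_mono (μ := (uniformOn Set.univ : Measure _)) hsub
    (measure_ne_top _ _)).trans (measureReal_biUnion_finset_le _ _)
  have hle' := hle.trans (Finset.sum_le_card_nsmul _ _ (2 * (1 / 2) ^ Λ) fun p hp =>
    uniformOn_not_wellSpread_le (by
      have := (Finset.mem_product.mp hp).2
      rw [Finset.mem_range] at this
      omega) p.1)
  rw [Finset.card_product, Finset.card_range, nsmul_eq_mul, hcompl] at hle'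
  push_cast at hle'
  linarith

end

/-! ### Broadcasting lists of words in blocks of rounds -/

section

open Classical

/-- A synchronous protocol in which, in each step, every node sends a list of numbers to all of its
neighbours.  In `step`, the lists received from the neighbours are indexed by identity numbers. -/
structure BroadcastProtocol where
  State : Type
  coins : ℕ
  init : LocalInput → (Fin coins → Bool) → State
  msg : State → List ℕ
  step : State → (ℕ → List ℕ) → State
  output : State → Option (List ℕ)
  estimate : List ℕ → List ℕ → ℕ

/-- The word that represents a number, if it fits into a word. -/
def toWord (n b x : ℕ) : Option (Word n b) := if h : x < n ^ b then some ⟨x, h⟩ else none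

theorem map_val_toWord {n b x : ℕ} (h : x < n ^ b) :
    (toWord n b x).map Fin.val = some x := by simp [toWord, h]

theorem map_val_filterMap_toWord {n b : ℕ} {l : List ℕ} (h : ∀ x ∈ l, x < n ^ b) :
    (l.filterMap (toWord n b)).map Fin.val = l := by
  induction l with
  | nil => rfl
  | cons x l ih =>
    have hx : toWord n b x = some ⟨x, h x (by simp)⟩ := by simp [toWord, h x (by simp)]
    rw [List.filterMap_cons_some hx, List.map_cons, ih fun y hy => h y (by simp [hy])]

namespace BroadcastProtocol

variable (P : BroadcastProtocol) {n a b B : ℕ} (N : Network n a)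
  (ω : Fin n → Fin P.coins → Bool)

/-- What `u` receives in a step in which every node `v` sends the list `l v` to its neighbours. -/
noncomputable def received (l : Fin n → List ℕ) (u : Fin n) : ℕ → List ℕ :=
  Function.extend N.id (fun v => if N.graph.Adj v u then l v else []) fun _ => []

/-- The states of all nodes after `t` steps. -/
noncomputable def run : ℕ → Fin n → P.State
  | 0 => fun v => P.init (N.localInput v) (ω v)
  | t + 1 => fun u => P.step (run t u) (received N (fun v => P.msg (run t v)) u)

/-- The simulation of a protocol with messages of one word: each step takes `B` rounds, in which
the lists are sent one word at a time.  The state consists of the state of the protocol, the number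
of rounds since the beginning of the step, and the words received in these rounds. -/
noncomputable abbrev simulation (n b B : ℕ) : SketchingAlgorithm n b where
  State := P.State × ℕ × (ℕ → List ℕ)
  coins := P.coins
  init inp x := (P.init inp x, 0, fun _ => [])
  send s _ := (P.msg s.1)[s.2.1]?.bind (toWord n b)
  receive s f :=
    if s.2.1 + 1 = B then
      (P.step s.1 fun i => s.2.2 i ++ ((f i).map Fin.val).toList, 0, fun _ => [])
    else (s.1, s.2.1 + 1, fun i => s.2.2 i ++ ((f i).map Fin.val).toList)
  output s := if s.2.1 = 0 then (P.output s.1).map (List.filterMap (toWord n b)) else none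
  estimate L L' := P.estimate (L.map Fin.val) (L'.map Fin.val)

/-- The configuration of the simulation after `p` rounds of step `t`. -/
noncomputable def blockConfig (n b B : ℕ) {a : ℕ} (N : Network n a)
    (ω : Fin n → Fin P.coins → Bool) (t p : ℕ) (u : Fin n) : (P.simulation n b B).State :=
  (P.run N ω t u, p, received N (fun v => (P.msg (P.run N ω t v)).take p) u)

theorem received_nil (u : Fin n) : received N (fun _ => []) u = fun _ => [] := by
  funext i
  simp only [received, ite_self]
  by_cases h : ∃ x, N.id x = i
  · obtain ⟨x, rfl⟩ := h
    rw [N.id_injective.extend_apply]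
  · rw [Function.extend_apply' _ _ _ h]

theorem received_append (l l' : Fin n → List ℕ) (u : Fin n) (i : ℕ) :
    received N l u i ++ received N l' u i = received N (fun v => l v ++ l' v) u i := by
  simp only [received]
  by_cases h : ∃ x, N.id x = i
  · obtain ⟨x, rfl⟩ := h
    simp only [N.id_injective.extend_apply]
    split_ifs <;> simp
  · simp [Function.extend_apply' _ _ _ h]

/-- A round of the simulation appends one word to what has been received in the current step. -/
theorem nextConfig_blockConfig {t p : ℕ}
    (hout : ∀ u, P.output (P.run N ω t u) = none)
    (hmsg : ∀ u, ∀ x ∈ P.msg (P.run N ω t u), x < n ^ b) (u : Fin n) :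
    (P.simulation n b B).nextConfig N (P.blockConfig n b B N ω t p) u =
      (if p + 1 = B then (P.step (P.run N ω t u)
        (received N (fun v => (P.msg (P.run N ω t v)).take (p + 1)) u), 0, fun _ => [])
      else (P.run N ω t u, p + 1,
        received N (fun v => (P.msg (P.run N ω t v)).take (p + 1)) u) :
        P.State × ℕ × (ℕ → List ℕ)) := by
  have hnone : ∀ v, (P.simulation n b B).output (P.blockConfig n b B N ω t p v) = none := fun v => by
    simp [blockConfig, hout]
  have hrec : ∀ i, ((Function.extend N.id
      (fun v => (P.simulation n b B).message N (P.blockConfig n b B N ω t p) v u)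
      (fun _ => none) i).map Fin.val).toList =
      received N (fun v => (P.msg (P.run N ω t v))[p]?.toList) u i := fun i => by
    by_cases h : ∃ x, N.id x = i
    · obtain ⟨v, rfl⟩ := h
      rw [received, N.id_injective.extend_apply, N.id_injective.extend_apply]
      by_cases hadj : N.graph.Adj v u
      · have hm : (P.simulation n b B).message N (P.blockConfig n b B N ω t p) v u =
            (P.msg (P.run N ω t v))[p]?.bind (toWord n b) := if_pos ⟨hadj, hnone v⟩
        rw [hm, if_pos hadj]
        rcases h : (P.msg (P.run N ω t v))[p]? with _ | x
        · rfl
        · rw [Option.bind_some, map_val_toWord (hmsg v x (List.mem_of_getElem? h))]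
      · have hm : (P.simulation n b B).message N (P.blockConfig n b B N ω t p) v u = none :=
          if_neg fun h => hadj h.1
        rw [hm, if_neg hadj]
        rfl
    · rw [received, Function.extend_apply' _ _ _ h, Function.extend_apply' _ _ _ h]
      rfl
  have hbuf : (fun i => received N (fun v => (P.msg (P.run N ω t v)).take p) u i ++
      ((Function.extend N.id
        (fun v => (P.simulation n b B).message N (P.blockConfig n b B N ω t p) v u)
        (fun _ => none) i).map Fin.val).toList) =
      received N (fun v => (P.msg (P.run N ω t v)).take (p + 1)) u := by
    funext i
    rw [hrec, received_append]
    simp only [List.take_add_one]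
  rw [← hbuf]
  exact if_pos (hnone u)

/-- As long as no node has stopped and all lists are short enough, the simulation is faithful. -/
theorem config_simulation (hB : 0 < B) {T : ℕ}
    (hout : ∀ t < T, ∀ u, P.output (P.run N ω t u) = none)
    (hlen : ∀ t < T, ∀ u, (P.msg (P.run N ω t u)).length ≤ B)
    (hmsg : ∀ t < T, ∀ u, ∀ x ∈ P.msg (P.run N ω t u), x < n ^ b) :
    (P.simulation n b B).config N ω (B * T) = P.blockConfig n b B N ω T 0 := by
  have hzero : ∀ t u, P.blockConfig n b B N ω t 0 u =
        (P.run N ω t u, 0, fun _ => []) := fun t u => by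
    simp only [blockConfig, List.take_zero, received_nil]
  induction T with
  | zero =>
    funext u
    rw [hzero]
    rfl
  | succ T ih =>
    have ih := ih (fun t ht => hout t (by omega)) (fun t ht => hlen t (by omega))
      (fun t ht => hmsg t (by omega))
    have hp : ∀ p < B, (P.simulation n b B).config N ω (B * T + p) = P.blockConfig n b B N ω T p := by
      intro p hp
      induction p with
      | zero => exact ih
      | succ p ihp =>
        funext u
        refine (congrArg (fun c => (P.simulation n b B).nextConfig N c u)
          (ihp (by omega))).trans ?_
        rw [P.nextConfig_blockConfig N ω (hout T (by omega)) (hmsg T (by omega)),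
          if_neg (by omega)]
        rfl
    obtain ⟨q, rfl⟩ : ∃ q, B = q + 1 := ⟨B - 1, by omega⟩
    funext u
    rw [show (q + 1) * (T + 1) = (q + 1) * T + q + 1 by ring]
    refine (congrArg (fun c => (P.simulation n b (q + 1)).nextConfig N c u)
      (hp q (by omega))).trans ?_
    rw [P.nextConfig_blockConfig N ω (hout T (by omega)) (hmsg T (by omega)),
      if_pos rfl, hzero]
    have : ∀ v, (P.msg (P.run N ω T v)).take (q + 1) = P.msg (P.run N ω T v) := fun v =>
      List.take_of_length_le (hlen T (by omega) v)
    simp only [this]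
    rfl

end BroadcastProtocol

namespace SketchingAlgorithm

variable {n a b : ℕ} (A : SketchingAlgorithm n b) (N : Network n a)

/-- At most one message is sent in each direction along each edge in each round. -/
theorem messageCount_le (ω : A.CoinFlips) (T : ℕ) :
    A.messageCount N ω T ≤ T * (2 * N.numEdges) := by
  refine (Finset.sum_le_card_nsmul _ _ (2 * N.numEdges) fun t _ => ?_).trans_eq (by simp)
  have hsub : {p : Fin n × Fin n | (A.message N (A.config N ω t) p.1 p.2).isSome} ⊆
      ((Finset.univ.filter fun p : Fin n × Fin n => N.graph.Adj p.1 p.2 :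
        Finset (Fin n × Fin n)) : Set (Fin n × Fin n)) := by
    intro p hp
    by_contra hadj
    simp only [Finset.coe_filter, Finset.mem_univ, true_and, Set.mem_ofPred_eq] at hadj
    simp [message, hadj] at hp
  refine (Set.ncard_le_ncard hsub (Finset.finite_toSet _)).trans_eq ?_
  rw [Set.ncard_coe_finset, Network.numEdges, Set.ncard_eq_toFinset_card',
    ← SimpleGraph.edgeFinset, ← SimpleGraph.sum_degrees_eq_twice_card_edges,
    Finset.card_filter, Finset.univ_product_univ.symm, Finset.sum_product]
  refine Finset.sum_congr rfl fun v _ => ?_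
  rw [← Finset.card_filter, ← SimpleGraph.card_neighborFinset_eq_degree]
  congr 1
  ext w
  simp

end SketchingAlgorithm

end

/-! ### The protocol that maintains the tables -/

section

open Classical

/-- An entry as a single number. -/
def encodeEntry (e : Entry) : ℕ := Nat.pair e.1 (Nat.pair e.2.1 e.2.2)

theorem encodeEntry_injective : Function.Injective encodeEntry := by
  rintro ⟨i, l, d⟩ ⟨i', l', d'⟩ h
  simp only [encodeEntry, Nat.pair_eq_pair] at h
  simp [h]

theorem encodeEntry_lt {M : ℕ} {e : Entry} (h1 : e.1 < M) (h2 : e.2.1 < M) (h3 : e.2.2 < M) :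
    encodeEntry e < M ^ 4 := by
  have h4 : Nat.pair e.2.1 e.2.2 < M ^ 2 :=
    (Nat.pair_lt_max_add_one_sq _ _).trans_le (Nat.pow_le_pow_left (max_lt h2 h3) 2)
  have h5 : M ≤ M ^ 2 := Nat.le_self_pow (by norm_num) M
  calc encodeEntry e < (M ^ 2) ^ 2 := (Nat.pair_lt_max_add_one_sq _ _).trans_le
        (Nat.pow_le_pow_left (max_lt (h1.trans_le h5) h4) 2)
    _ = M ^ 4 := by ring

/-- The codes of the entries of a table, in some order; it is empty if the table is infinite. -/
noncomputable def encodeTable (E : Set Entry) : List ℕ :=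
  if h : E.Finite then h.toFinset.toList.map encodeEntry else []

/-- The set of the entries whose codes occur in a list. -/
def decodeTable (l : List ℕ) : Set Entry := {e | encodeEntry e ∈ l}

theorem decodeTable_encodeTable {E : Set Entry} (hE : E.Finite) :
    decodeTable (encodeTable E) = E := by
  ext e
  simp only [decodeTable, encodeTable, hE, dif_pos, Set.mem_ofPred_eq,
    List.mem_map_of_injective encodeEntry_injective, Finset.mem_toList, Set.Finite.mem_toFinset]

theorem length_encodeTable {E : Set Entry} (hE : E.Finite) :
    (encodeTable E).length = E.ncard := by
  simp [encodeTable, hE, Set.ncard_eq_toFinset_card E hE]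

theorem mem_encodeTable {E : Set Entry} {x : ℕ} (h : x ∈ encodeTable E) :
    ∃ e ∈ E, encodeEntry e = x := by
  rw [encodeTable] at h
  split_ifs at h
  · simpa using h
  · simp at h

/-- What a node remembers: its initial knowledge, the time, its table, and the time after the
last change of a table that it has heard of. -/
structure TableState where
  input : LocalInput
  time : ℕ
  table : Set Entry
  lastChange : ℕ

/-- The protocol that maintains the tables. A node draws its level from its `k` coins.  In each step
it sends the time after the last known change and its table. -/
noncomputable def tableProtocol (k : ℕ) : BroadcastProtocol where
  State := TableState
  coins := k
  init inp x := ⟨inp, 0, {(inp.id, coinLevel k x, 0)}, 0⟩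
  msg s := s.lastChange :: encodeTable s.table
  step s R :=
    let E := entryFront (relaxedEntries s.input.nbrWeight s.table fun i => decodeTable (R i).tail)
    ⟨s.input, s.time + 1, E,
      if E = s.table then max s.lastChange (⨆ i, (R i).headD 0) else s.time + 1⟩
  output s := if 3 * s.lastChange + 2 ≤ s.time then some (encodeTable s.table) else none
  estimate l l' := tableEstimate (decodeTable l) (decodeTable l')

variable {n a k : ℕ} (N : Network n a)

theorem iSup_headD_received (l : Fin n → List ℕ) (u : Fin n) :
    ⨆ i, (BroadcastProtocol.received N l u i).headD 0 =
      Finset.univ.sup fun x => if N.graph.Adj u x then (l x).headD 0 else 0 := by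
  have hval : ∀ x, (BroadcastProtocol.received N l u (N.id x)).headD 0 =
      if N.graph.Adj u x then (l x).headD 0 else 0 := fun x => by
    rw [BroadcastProtocol.received, N.id_injective.extend_apply, N.graph.adj_comm]
    split_ifs <;> rfl
  have hle : ∀ i, (BroadcastProtocol.received N l u i).headD 0 ≤
      Finset.univ.sup fun x => if N.graph.Adj u x then (l x).headD 0 else 0 := fun i => by
    by_cases h : ∃ x, N.id x = i
    · obtain ⟨x, rfl⟩ := h
      rw [hval]
      exact Finset.le_sup (f := fun x => if N.graph.Adj u x then (l x).headD 0 else 0)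
        (Finset.mem_univ x)
    · rw [BroadcastProtocol.received, Function.extend_apply' _ _ _ h]
      exact Nat.zero_le _
  refine le_antisymm (ciSup_le hle) (Finset.sup_le fun x _ => ?_)
  rw [← hval]
  exact le_ciSup (f := fun i => (BroadcastProtocol.received N l u i).headD 0)
    ⟨_, by rintro _ ⟨i, rfl⟩; exact hle i⟩ (N.id x)

theorem run_tableProtocol (ω : Fin n → Fin k → Bool) (t : ℕ) (u : Fin n) :
    (tableProtocol k).run N ω t u = (⟨N.localInput u, t,
      N.table (fun w => coinLevel k (ω w)) t u,
      N.lastChange (fun w => coinLevel k (ω w)) t u⟩ : TableState) := by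
  induction t generalizing u with
  | zero =>
    rw [Network.table_zero]
    rfl
  | succ t ih =>
    set lev := fun w => coinLevel k (ω w) with hlev
    set l := fun v => N.lastChange lev t v :: encodeTable (N.table lev t v) with hl
    have hR : ∀ x, N.graph.Adj u x →
        decodeTable (BroadcastProtocol.received N l u (N.id x)).tail = N.table lev t x := by
      intro x hx
      rw [BroadcastProtocol.received, N.id_injective.extend_apply, if_pos hx.symm]
      exact decodeTable_encodeTable (N.table_finite t x)
    have hstep : (tableProtocol k).run N ω (t + 1) u = (tableProtocol k).step
        (⟨N.localInput u, t, N.table lev t u, N.lastChange lev t u⟩ : TableState)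
        (BroadcastProtocol.received N l u) := by
      simp only [BroadcastProtocol.run, ih]
      rfl
    rw [hstep]
    simp only [tableProtocol]
    rw [← N.table_succ (R := fun i => decodeTable (BroadcastProtocol.received N l u i).tail) hR,
      iSup_headD_received]
    rfl

/-! ### Parameters -/

/-- The number of binary digits of `n`. -/
def logSize (n : ℕ) : ℕ := Nat.log 2 n + 1

theorem logSize_le {n : ℕ} (hn : 2 ≤ n) : (logSize n : ℝ) ≤ 3 * Real.log n := by
  have h1 : ((Nat.log 2 n : ℕ) : ℝ) * Real.log 2 ≤ Real.log n := by
    rw [← Real.log_pow]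
    refine Real.log_le_log (by positivity) ?_
    exact_mod_cast Nat.pow_log_le_self 2 (by omega)
  have h2 := Real.log_two_gt_d9
  have h3 : Real.log 2 ≤ Real.log n := Real.log_le_log (by norm_num) (by exact_mod_cast hn)
  rw [logSize]
  push_cast
  have h4 : (0 : ℝ) ≤ (Nat.log 2 n : ℕ) := Nat.cast_nonneg _
  nlinarith

/-- The number of rounds in a step of the simulation. -/
def blockLength (n Λ : ℕ) : ℕ := logSize n * (5 * Λ + 1) + 1

theorem blockLength_le {n : ℕ} (hn : 2 ≤ n) (K : ℕ) :
    (blockLength n (K * logSize n) : ℝ) ≤ 27 * (5 * K + 2) * Real.log n ^ 4 := by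
  have h1 := logSize_le hn
  have h2 : (1 : ℝ) ≤ logSize n := by simp [logSize]
  have h3 : Real.log 2 ≤ Real.log n := Real.log_le_log (by norm_num) (by exact_mod_cast hn)
  have h4 := Real.log_two_gt_d9
  have h5 : 1 ≤ 3 * Real.log n ^ 2 := by nlinarith
  have hK : (0 : ℝ) ≤ K := Nat.cast_nonneg K
  calc (blockLength n (K * logSize n) : ℝ)
      = 5 * K * (logSize n : ℝ) ^ 2 + (logSize n + 1) := by
        rw [blockLength]
        push_cast
        ring
    _ ≤ 5 * K * (logSize n : ℝ) ^ 2 + 2 * (logSize n : ℝ) ^ 2 := by nlinarith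
    _ = (5 * K + 2) * (logSize n : ℝ) ^ 2 := by ring
    _ ≤ (5 * K + 2) * (3 * Real.log n) ^ 2 := by gcongr
    _ = 9 * (5 * K + 2) * Real.log n ^ 2 * 1 := by ring
    _ ≤ 9 * (5 * K + 2) * Real.log n ^ 2 * (3 * Real.log n ^ 2) := by gcongr
    _ = _ := by ring

theorem one_half_pow_mul_logSize_le {n : ℕ} (hn : 0 < n) (K : ℕ) :
    ((1 : ℝ) / 2) ^ (K * logSize n) ≤ 1 / (n : ℝ) ^ K := by
  have h : (n : ℝ) ≤ 2 ^ logSize n := by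
    exact_mod_cast (Nat.lt_pow_succ_log_self (b := 2) (by norm_num) n).le
  have hn' : (0 : ℝ) < n := by exact_mod_cast hn
  rw [mul_comm, pow_mul, one_div_pow, one_div_pow]
  gcongr

/-- The sets on which the levels have to be well spread. -/
noncomputable def Network.testSets (N : Network n a) : Finset (Finset (Fin n)) :=
  (Finset.range (N.shortestPathDiam + 1) ×ˢ (Finset.univ : Finset (Fin n × Fin n))).image
      (fun p => N.before p.1 p.2.1 p.2.2) ∪
    (Finset.univ : Finset (Fin n × Fin n)).image fun p => N.closer p.1 p.2

theorem Network.card_testSets_le (hn : 2 ≤ n) : N.testSets.card ≤ n ^ 4 := by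
  have hS := N.shortestPathDiam_lt (by omega)
  calc N.testSets.card ≤ (N.shortestPathDiam + 1) * (n * n) + n * n := by
        refine (Finset.card_union_le _ _).trans (add_le_add ?_ ?_)
        · exact Finset.card_image_le.trans (by simp)
        · exact Finset.card_image_le.trans (by simp)
    _ ≤ n * (n * n) + n * (n * n) := by
        refine add_le_add (Nat.mul_le_mul_right _ hS) (Nat.le_mul_of_pos_left _ (by omega))
    _ = 2 * n ^ 3 := by ring
    _ ≤ n * n ^ 3 := Nat.mul_le_mul_right _ hn
    _ = n ^ 4 := by ring

/-- There are at most `n ^ 4` test sets and `n` levels, and each pair of them fails with probability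
at most `2 / n ^ (c + 6)`. -/
theorem one_sub_le_uniformOn_testSets (hn : 2 ≤ n) (hk : k + 1 ≤ n) (c : ℕ) :
    1 - 1 / (n : ℝ) ^ c ≤ (uniformOn Set.univ : Measure (Fin n → Fin k → Bool)).real
      {ω | ∀ F ∈ N.testSets, ∀ i ≤ k,
        WellSpread (fun w => coinLevel k (ω w)) ((c + 6) * logSize n) i F} := by
  refine le_trans ?_ (one_sub_le_uniformOn_wellSpread _ _)
  have hn' : (0 : ℝ) < n := by
    have : 0 < n := by omega
    exact_mod_cast this
  have h1 : (N.testSets.card : ℝ) ≤ (n : ℝ) ^ 4 := by exact_mod_cast N.card_testSets_le hn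
  have h2 : ((k : ℝ) + 1) ≤ n := by exact_mod_cast hk
  have h3 : (2 : ℝ) ≤ n := by exact_mod_cast hn
  have h4 := one_half_pow_mul_logSize_le (n := n) (by omega) (c + 6)
  have : (N.testSets.card * ((k : ℝ) + 1)) * (2 * (1 / 2) ^ ((c + 6) * logSize n)) ≤
      (n : ℝ) ^ 4 * n * (n * (1 / (n : ℝ) ^ (c + 6))) := by gcongr
  have h5 : (n : ℝ) ^ 4 * n * (n * (1 / (n : ℝ) ^ (c + 6))) = 1 / (n : ℝ) ^ c := by
    rw [pow_add]
    field_simp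
  linarith

/-! ### The run of the algorithm on well spread levels -/

/-- The number of coins of a node, which is the highest level. -/
def maxLevel (n Λ : ℕ) : ℕ := Nat.log 2 (n / Λ)

theorem maxLevel_add_one_le (n Λ : ℕ) : maxLevel n Λ + 1 ≤ logSize n :=
  Nat.succ_le_succ (Nat.log_mono_right (Nat.div_le_self n Λ))

theorem lt_mul_two_pow_maxLevel (n : ℕ) {Λ : ℕ} (hΛ : 0 < Λ) :
    n < Λ * 2 ^ (maxLevel n Λ + 1) := by
  rw [mul_comm]
  exact (Nat.div_lt_iff_lt_mul hΛ).mp (Nat.lt_pow_succ_log_self (by norm_num) _)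

/-- The sketching algorithm for networks with `n` nodes. -/
noncomputable def bunchAlgorithm (a Λ n : ℕ) : SketchingAlgorithm n (4 * (a + 4)) :=
  (tableProtocol (maxLevel n Λ)).simulation n (4 * (a + 4)) (blockLength n Λ)

theorem estimate_bunchAlgorithm (a Λ n : ℕ) (L L' : List (Word n (4 * (a + 4)))) :
    (bunchAlgorithm a Λ n).estimate L L' =
      tableEstimate (decodeTable (L.map Fin.val)) (decodeTable (L'.map Fin.val)) :=
  rfl

section

variable {Λ : ℕ} {ω : Fin n → Fin (maxLevel n Λ) → Bool} (hΛ : 0 < Λ)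
  (hω : ∀ F ∈ N.testSets, ∀ i ≤ maxLevel n Λ,
    WellSpread (fun w => coinLevel (maxLevel n Λ) (ω w)) Λ i F)

include hΛ hω

theorem length_encodeTable_lt (t : ℕ) (u : Fin n) :
    (encodeTable (N.table (fun w => coinLevel (maxLevel n Λ) (ω w)) t u)).length <
      blockLength n Λ := by
  rw [length_encodeTable (N.table_finite t u), ← N.table_min_shortestPathDiam, blockLength,
    Nat.lt_succ_iff]
  refine (N.ncard_table_le (fun w => coinLevel_le _ _) (lt_mul_two_pow_maxLevel n hΛ)
    fun i hi v => hω _ ?_ i hi).trans (Nat.mul_le_mul_right _ (maxLevel_add_one_le n Λ))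
  refine Finset.mem_union_left _ (Finset.mem_image.mpr ⟨(min t N.shortestPathDiam, u, v), ?_, rfl⟩)
  simp

omit hΛ hω in
theorem lt_of_mem_encodeTable (hn : 2 ≤ n) (t : ℕ) (u : Fin n) {x : ℕ}
    (hx : x ∈ encodeTable (N.table (fun w => coinLevel (maxLevel n Λ) (ω w)) t u)) :
    x < n ^ (4 * (a + 4)) := by
  obtain ⟨e, ⟨w, d, hd, -, rfl⟩, rfl⟩ := mem_encodeTable hx
  rw [mul_comm, pow_mul]
  have hpow : ∀ {i j : ℕ}, i < j → n ^ i < n ^ j := fun h => Nat.pow_lt_pow_right hn h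
  refine encodeEntry_lt ((N.id_lt w).trans (hpow (by omega))) ?_ ?_
  · have h1 : maxLevel n Λ ≤ Nat.log 2 n := Nat.log_mono_right (Nat.div_le_self n Λ)
    calc coinLevel (maxLevel n Λ) (ω w) ≤ maxLevel n Λ := coinLevel_le _ _
      _ < n ^ 1 := by
        rw [pow_one]
        exact h1.trans_lt (Nat.log_lt_self 2 (by omega))
      _ < n ^ (a + 4) := hpow (by omega)
  · calc d ≤ n * n ^ a := N.le_of_hopDist_eq hd
      _ = n ^ (a + 1) := by ring
      _ < n ^ (a + 4) := hpow (by omega)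

/-- On well spread levels, all nodes stop at the end of the same step of the simulation, and their
sketches are the final tables. -/
theorem exists_completes_bunchAlgorithm (hn : 2 ≤ n) :
    ∃ (T : ℕ) (L : Fin n → List (Word n (4 * (a + 4)))),
      (bunchAlgorithm a Λ n).Completes N ω (blockLength n Λ * T) L ∧
      T ≤ 5 * N.shortestPathDiam ∧
      (∀ v, (L v).length ≤ blockLength n Λ) ∧
      ∀ v, decodeTable ((L v).map Fin.val) =
        N.table (fun w => coinLevel (maxLevel n Λ) (ω w)) N.shortestPathDiam v := by
  set lev := fun w => coinLevel (maxLevel n Λ) (ω w) with hlev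
  set u₀ : Fin n := ⟨0, by omega⟩
  have hS := N.shortestPathDiam_pos hn
  have hS' := N.shortestPathDiam_lt (by omega)
  have hex : ∃ t, N.Settled lev t u₀ := ⟨_, N.settled_of_shortestPathDiam_le le_rfl u₀⟩
  set T := Nat.find hex with hT
  have hTle : T ≤ 3 * N.shortestPathDiam + 2 :=
    Nat.find_min' hex (N.settled_of_shortestPathDiam_le le_rfl u₀)
  have hset : ∀ v, N.Settled lev T v := N.settled_of_settled (Nat.find_spec hex)
  have hnot : ∀ t < T, ∀ v, ¬ N.Settled lev t v := fun t ht v h =>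
    Nat.find_min hex ht (N.settled_of_settled h u₀)
  have hconfig := (tableProtocol (maxLevel n Λ)).config_simulation (b := 4 * (a + 4)) N ω
    (B := blockLength n Λ) (T := T) (Nat.succ_pos _)
    (fun t ht u => by
      rw [run_tableProtocol]
      exact if_neg (hnot t ht u))
    (fun t ht u => by
      rw [run_tableProtocol]
      exact length_encodeTable_lt N hΛ hω t u)
    (fun t ht u x hx => by
      rw [run_tableProtocol] at hx
      rcases List.mem_cons.mp hx with rfl | hx
      · calc N.lastChange lev t u ≤ t := N.lastChange_le_self t u
          _ < 3 * n := by omega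
          _ ≤ n ^ 2 * n := Nat.mul_le_mul_right _ (by nlinarith)
          _ = n ^ 3 := by ring
          _ ≤ n ^ (4 * (a + 4)) := Nat.pow_le_pow_right (by omega) (by omega)
      · exact lt_of_mem_encodeTable N hn t u hx)
  refine ⟨T, fun v => (encodeTable (N.table lev T v)).filterMap (toWord n (4 * (a + 4))),
    fun v => ?_, by omega, fun v => ?_, fun v => ?_⟩
  · have hout : (tableProtocol (maxLevel n Λ)).output
        ((tableProtocol (maxLevel n Λ)).run N ω T v) = some (encodeTable (N.table lev T v)) := by
      rw [run_tableProtocol]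
      exact if_pos (hset v)
    refine (congrArg (fun s => (bunchAlgorithm a Λ n).output (s v)) hconfig).trans ?_
    simp only [bunchAlgorithm, BroadcastProtocol.blockConfig, if_true, hout, Option.map_some]
  · exact (List.length_filterMap_le _ _).trans (length_encodeTable_lt N hΛ hω T v).le
  · rw [map_val_filterMap_toWord fun x hx => lt_of_mem_encodeTable N hn T v hx,
      decodeTable_encodeTable (N.table_finite T v), N.table_eq_of_settled (hset v)]

end

end

theorem mainTheorem4 (a c : ℕ) :
    ∃ (b : ℕ) (C : ℝ) (A : (n : ℕ) → SketchingAlgorithm n b),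
      ∀ n : ℕ, 2 ≤ n → ∀ N : Network n a,
        1 - 1 / (n : ℝ) ^ c ≤ (A n).coinLaw.real
          {ω | ∃ (T : ℕ) (L : Fin n → List (Word n b)),
            (A n).Completes N ω T L ∧
            (T : ℝ) ≤ C * (N.shortestPathDiam * Real.log n ^ 4) ∧
            ((A n).messageCount N ω T : ℝ) ≤
              C * (N.shortestPathDiam * N.numEdges * Real.log n ^ 4) ∧
            (∀ v, ((L v).length : ℝ) ≤ C * Real.log n ^ 4) ∧
            N.IsGracefullyDegrading (fun u v => (A n).estimate (L u) (L v))
              (fun ε => C * (1 + Real.log (1 / ε)))} := by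
  -- A step of the simulation takes at most `Q * log n ^ 4` rounds, there are at most `5 * S` steps,
  -- and in each round at most two messages are sent along an edge.
  set Q : ℝ := 27 * (5 * ((c + 6 : ℕ) : ℝ) + 2) with hQ
  have hQ1 : 1 ≤ Q := by
    have : (0 : ℝ) ≤ ((c + 6 : ℕ) : ℝ) := Nat.cast_nonneg _
    rw [hQ]
    linarith
  refine ⟨4 * (a + 4), 10 * Q,
    fun n => bunchAlgorithm a ((c + 6) * logSize n) n, fun n hn N => ?_⟩
  set Λ := (c + 6) * logSize n with hΛ
  have hΛ0 : 0 < Λ := Nat.mul_pos (by omega) (Nat.succ_pos _)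
  have hk : maxLevel n Λ + 1 ≤ n :=
    (maxLevel_add_one_le n Λ).trans (Nat.log_lt_self 2 (by omega))
  refine (one_sub_le_uniformOn_testSets N hn hk c).trans ?_
  have : IsProbabilityMeasure (uniformOn Set.univ : Measure (Fin n → Fin (maxLevel n Λ) → Bool)) :=
    isProbabilityMeasure_uniformOn Set.finite_univ Set.univ_nonempty
  refine measureReal_mono (fun ω hω => ?_) (measure_ne_top _ _)
  obtain ⟨T, L, hcomp, hT, hlen, htab⟩ := exists_completes_bunchAlgorithm N hΛ0 hω hn
  have hB : (blockLength n Λ : ℝ) ≤ Q * Real.log n ^ 4 := blockLength_le hn (c + 6)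
  have hlog : 0 ≤ Real.log n ^ 4 := by positivity
  have hrounds : ((blockLength n Λ * T : ℕ) : ℝ) ≤
      5 * Q * (N.shortestPathDiam * Real.log n ^ 4) := by
    have hT' : (T : ℝ) ≤ 5 * N.shortestPathDiam := by exact_mod_cast hT
    calc ((blockLength n Λ * T : ℕ) : ℝ) = blockLength n Λ * T := by push_cast; rfl
      _ ≤ (Q * Real.log n ^ 4) * (5 * N.shortestPathDiam) := by gcongr
      _ = _ := by ring
  refine ⟨blockLength n Λ * T, L, hcomp, ?_, ?_, fun v => ?_, ?_⟩
  · refine hrounds.trans (mul_le_mul_of_nonneg_right ?_ (by positivity))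
    linarith
  · have h1 := Nat.cast_le (α := ℝ).mpr
      ((bunchAlgorithm a Λ n).messageCount_le N ω (blockLength n Λ * T))
    refine h1.trans ?_
    rw [Nat.cast_mul]
    refine (mul_le_mul_of_nonneg_right hrounds (Nat.cast_nonneg _)).trans_eq ?_
    push_cast
    ring
  · have h1 : ((L v).length : ℝ) ≤ blockLength n Λ := by exact_mod_cast hlen v
    refine h1.trans (hB.trans ?_)
    have : 0 ≤ Q * Real.log n ^ 4 := by positivity
    linarith
  · simp only [estimate_bunchAlgorithm, htab]
    refine N.isGracefullyDegrading_tableEstimate hΛ0 rfl (fun w => coinLevel_le _ _)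
      (fun i hi u v => hω _ ?_ i hi) (by linarith)
    exact Finset.mem_union_right _ (Finset.mem_image.mpr ⟨(u, v), Finset.mem_univ _, rfl⟩)
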